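/- Let $H$ be a real Hilbert space and let $A$ be a positive self-adjoint (possibly unbounded) linear operator on $H$, that is, $A=A^*$ and $\langle Au,u\rangle\ge 0$ for all $u\in D(A)$. For $\alpha>0$ let $A^\alpha$ be the fractional power of $A$ given by the spectral theorem, $A^\alpha=\int t^\alpha\,dE_t$, where $A=\int t\,dE_t$ with $(E_t)$ the spectral family of $A$. For a positive self-adjoint operator $B$ on $H$ and $s>0$, let $G(B,s)$ be the set of all $u\in H$ such that $u\in D(B^n)$ for every $n\in\mathbb{N}$ and such that there is $R>0$ with $$\|B^n u\|\le R^n\, n^{sn}\qquad\text{for all integers } n\ge 1 .$$ Then for all real numbers $\alpha,s>0$, $$G(A,s)=G(A^\alpha,\alpha s).$$ -/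

import Mathlib

open scoped RealInnerProductSpace

noncomputable section

namespace GevreyVectors

open MeasureTheory Filter Topology Set

variable {H : Type*} [NormedAddCommGroup H] [InnerProductSpace ℝ H]

/-! ### Unbounded operators: composition, powers, positivity -/

/-- The elements `x` of `D(f)` such that `f x` belongs to `D(g)`. -/
def compDomain (g f : H →ₗ.[ℝ] H) : Submodule ℝ H :=
  (g.domain.comap f.toFun).map f.domain.subtype

/-- The product `g f` of two unbounded operators, with its natural domain
`{x ∈ D(f) | f x ∈ D(g)}`. -/
def pcomp (g f : H →ₗ.[ℝ] H) : H →ₗ.[ℝ] H :=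
  g.comp (f.domRestrict (compDomain g f)) (by
    rintro ⟨x, hx⟩
    obtain ⟨⟨y, hy, rfl⟩, -⟩ := id hx
    have e : f.domRestrict (compDomain g f) ⟨f.domain.subtype y, hx⟩ = f y :=
      LinearPMap.domRestrict_apply rfl
    exact e ▸ hy)

theorem mem_pcomp_domain (g f : H →ₗ.[ℝ] H) (x : H) :
    x ∈ (pcomp g f).domain ↔ ∃ h : x ∈ f.domain, f ⟨x, h⟩ ∈ g.domain := by
  constructor
  · rintro ⟨⟨y, hy, rfl⟩, -⟩
    exact ⟨y.2, hy⟩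
  · rintro ⟨h, hg⟩
    exact ⟨⟨⟨x, h⟩, hg, rfl⟩, h⟩

theorem pcomp_apply (g f : H →ₗ.[ℝ] H) (x : H) (h : x ∈ (pcomp g f).domain)
    (hf : x ∈ f.domain) (hg : f ⟨x, hf⟩ ∈ g.domain) :
    pcomp g f ⟨x, h⟩ = g ⟨f ⟨x, hf⟩, hg⟩ := by
  change g _ = g _
  congr 1

/-- The powers `A ^ n` of an unbounded operator, with their natural domains:
`A ^ 0` is the identity on `H` and `A ^ (n + 1) = A (A ^ n)`. -/
def pow (A : H →ₗ.[ℝ] H) : ℕ → (H →ₗ.[ℝ] H)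
  | 0 => ⟨⊤, (⊤ : Submodule ℝ H).subtype⟩
  | n + 1 => pcomp A (pow A n)

/-- `A` is a positive self-adjoint operator: it is equal to its adjoint (in particular it is densely
defined) and `⟪A u, u⟫ ≥ 0` for every `u ∈ D(A)`. No coercivity or injectivity is required. -/
structure IsPositiveSelfAdjoint [CompleteSpace H] (A : H →ₗ.[ℝ] H) : Prop where
  isSelfAdjoint : IsSelfAdjoint A
  nonneg : ∀ u : A.domain, 0 ≤ ⟪A u, (u : H)⟫

/-! ### Gevrey vectors -/

/-- The set `G(A, s)` of Gevrey vectors of order `s` with respect to `A`. -/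
def gevrey (A : H →ₗ.[ℝ] H) (s : ℝ) : Set H :=
  {u | ∃ hu : ∀ n : ℕ, u ∈ (pow A n).domain, ∃ R : ℝ, 0 < R ∧
    ∀ n : ℕ, 1 ≤ n → ‖pow A n ⟨u, hu n⟩‖ ≤ R ^ n * (n : ℝ) ^ (s * n)}

/-! ### Spectral families and fractional powers -/

/-- A spectral family (resolution of the identity) on `H`: an increasing, strongly right-continuous
family of orthogonal projections with strong limits `0` at `-∞` and the identity at `+∞`. -/
structure SpectralFamily (H : Type*) [NormedAddCommGroup H] [InnerProductSpace ℝ H]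
    [CompleteSpace H] where
  proj : ℝ → H →L[ℝ] H
  isStarProjection : ∀ t, IsStarProjection (proj t)
  mul_of_le : ∀ t t', t ≤ t' → proj t' * proj t = proj t
  right_cont : ∀ u t, ContinuousWithinAt (fun t' => proj t' u) (Ici t) t
  tendsto_atBot : ∀ u, Tendsto (fun t => proj t u) atBot (𝓝 0)
  tendsto_atTop : ∀ u, Tendsto (fun t => proj t u) atTop (𝓝 u)

variable [CompleteSpace H]

theorem inner_proj_mono (E : SpectralFamily H) (u : H) : Monotone fun t => ⟪E.proj t u, u⟫ := by
  have key : ∀ t, ⟪E.proj t u, u⟫ = ‖E.proj t u‖ ^ 2 := by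
    intro t
    have h2 : E.proj t (E.proj t u) = E.proj t u :=
      DFunLike.congr_fun (E.isStarProjection t).isIdempotentElem u
    have h3 := (ContinuousLinearMap.isSelfAdjoint_iff_isSymmetric.1
      (E.isStarProjection t).isSelfAdjoint) (E.proj t u) u
    simp only [ContinuousLinearMap.coe_coe] at h3
    rw [h2] at h3
    rw [h3, real_inner_self_eq_norm_sq]
  intro t t' htt'
  have h1 : E.proj t' (E.proj t u) = E.proj t u := DFunLike.congr_fun (E.mul_of_le t t' htt') u
  have h3 := (ContinuousLinearMap.isSelfAdjoint_iff_isSymmetric.1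
      (E.isStarProjection t').isSelfAdjoint) (E.proj t u) u
  simp only [ContinuousLinearMap.coe_coe] at h3
  rw [h1] at h3
  have h4 := real_inner_le_norm (E.proj t u) (E.proj t' u)
  rw [← h3] at h4
  change ⟪E.proj t u, u⟫ ≤ ⟪E.proj t' u, u⟫
  rw [key] at h4
  rw [key, key]
  have := norm_nonneg (E.proj t u)
  have := norm_nonneg (E.proj t' u)
  nlinarith

/-- The nondecreasing right-continuous function `t ↦ ⟪E_t u, u⟫ = ‖E_t u‖ ^ 2`. -/
def SpectralFamily.distribution (E : SpectralFamily H) (u : H) : StieltjesFunction ℝ where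
  toFun t := ⟪E.proj t u, u⟫
  mono' := inner_proj_mono E u
  right_continuous' t := ContinuousWithinAt.inner (𝕜 := ℝ) (E.right_cont u t) continuousWithinAt_const

/-- The spectral measure `d⟪E_t u, u⟫` of the vector `u`. -/
def SpectralFamily.measure (E : SpectralFamily H) (u : H) : Measure ℝ :=
  (E.distribution u).measure

/-- The operator `B` is the spectral integral `∫ f(t) dE_t`: it is symmetric, its domain is
`{u | ∫ f(t) ^ 2 d⟪E_t u, u⟫ < ∞}`, and `⟪B u, u⟫ = ∫ f(t) d⟪E_t u, u⟫` on this domain.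
(The domain is dense and the quadratic form of a symmetric operator determines `⟪B u, v⟫` for all
`u, v` in the domain by polarization, so there is exactly one such `B`.) -/
structure SpectralFamily.IsIntegral (E : SpectralFamily H) (f : ℝ → ℝ) (B : H →ₗ.[ℝ] H) :
    Prop where
  symm : B.IsFormalAdjoint B
  mem_domain_iff : ∀ u : H, u ∈ B.domain ↔ MemLp f 2 (E.measure u)
  inner_eq : ∀ u : B.domain, ⟪B u, (u : H)⟫ = ∫ t, f t ∂(E.measure (u : H))

/-- `B` is the fractional power of order `α` of `A` in the sense of the spectral theorem:
`A = ∫ t dE_t` and `B = ∫ t ^ α dE_t` for a spectral family `E`. When `A` is positive, the spectral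
measures are carried by `[0, ∞)`, so the values of `t ^ α` for `t < 0` play no role. -/
def IsFracPow (A : H →ₗ.[ℝ] H) (α : ℝ) (B : H →ₗ.[ℝ] H) : Prop :=
  ∃ E : SpectralFamily H, E.IsIntegral (fun t => t) A ∧ E.IsIntegral (fun t => t ^ α) B

open Classical in
/-- The fractional power `A ^ α` of a positive self-adjoint operator: the operator given by the
spectral theorem (and `⊥` for those operators `A` that have no spectral family). -/
def fracPow (A : H →ₗ.[ℝ] H) (α : ℝ) : H →ₗ.[ℝ] H :=
  if h : ∃ B, IsFracPow A α B then h.choose else ⊥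

end GevreyVectors

end

/-!
If `A = ∫ t dE_t` and `μ_u = d⟪E_t u, u⟫` is the spectral measure of `u`, then
`‖A ^ n u‖ ^ 2 = ∫ t ^ (2 n) dμ_u` and `‖(A ^ α) ^ n u‖ ^ 2 = ∫ t ^ (2 α n) dμ_u`, and `μ_u` is a
finite measure carried by `[0, ∞)`. Thus both Gevrey conditions are growth conditions on moments of
the same measure (`SpectralFamily.IsIntegral.mem_gevrey_iff`), and they imply each other by
comparing the moment of order `q n` with that of order `p ⌈q n / p⌉` (`gevrey_moments`).

The substance is that the fractional power exists, which requires the spectral theorem for `A`, and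
that the conditions in `SpectralFamily.IsIntegral` determine the powers of the operator. Both rest
on one notion, `FunctionalCalculus`: a family of bounded functions and corresponding symmetric
operators, with measures `μ_u` representing the quadratic forms. The map that sends a function `f`
of the family to the vector `f(T) u` extends to an isometry from `L²(μ_u)` to `H`, and
`FunctionalCalculus.int u f` is its value at `f`. The spectral measure of `int u f` is `f² μ_u`
(`measure_int`), from which multiplicativity of the calculus and all statements about unbounded
functions follow. There are two instances.

* Step functions and the projections of a spectral family (`SpectralFamily.calculus`).
* Polynomials on `[0, 1]` and a symmetric operator `0 ≤ T ≤ 1`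
  (`IsPositiveContraction.calculus`). The measures come from the Riesz–Markov–Kakutani theorem, once
  polynomials that are nonnegative on `[0, 1]` are known to yield positive operators
  (`inner_aeval_nonneg`); this uses the factorization of real polynomials and requires no
  complexification.

The second instance is applied to `T = (1 + A)⁻¹`, and the projections of `A` are the spectral
projections of the sets `{x | x⁻¹ - 1 ≤ t}` (`IsPositiveSelfAdjoint.exists_spectralFamily`).
-/

noncomputable section

namespace GevreyVectors

open MeasureTheory Filter Topology Set
open scoped ENNReal

/-! ### Functional calculi and spectral integrals of vectors -/

theorem memLp_two_add_measure {X : Type*} [MeasurableSpace X] {μ ν : Measure X} {f : X → ℝ} :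
    MemLp f 2 (μ + ν) ↔ MemLp f 2 μ ∧ MemLp f 2 ν := by
  refine ⟨fun h => ⟨h.left_of_add_measure, h.right_of_add_measure⟩, fun ⟨h1, h2⟩ => ?_⟩
  rw [memLp_two_iff_integrable_sq (h1.1.add_measure h2.1), integrable_add_measure]
  exact ⟨h1.integrable_sq, h2.integrable_sq⟩

theorem memLp_of_bounded {X : Type*} [MeasurableSpace X] {f : X → ℝ} (hfm : Measurable f) {C : ℝ}
    (hC : ∀ x, |f x| ≤ C) (p : ℝ≥0∞) (ν : Measure X) [IsFiniteMeasure ν] : MemLp f p ν :=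
  MemLp.of_bound hfm.aestronglyMeasurable C (ae_of_all _ hC)

/-- A functional calculus on a real Hilbert space `H`: a linear family of symmetric bounded
operators `op c` and of bounded measurable functions `fn c` on `X`, indexed by a vector space `M`,
such that products of functions correspond to products of operators, together with finite
measures `measure u` representing the quadratic forms `⟪op c u, u⟫`. The functions `fn c` are
assumed to separate finite measures. The index space `M` replaces an algebra of functions, so that
`op` need not be shown to factor through `fn`. -/
structure FunctionalCalculus (X M H : Type*) [MeasurableSpace X] [AddCommGroup M] [Module ℝ M]
    [NormedAddCommGroup H] [InnerProductSpace ℝ H] where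
  fn : M →ₗ[ℝ] X → ℝ
  op : M →ₗ[ℝ] H →L[ℝ] H
  measure : H → Measure X
  isFiniteMeasure : ∀ u, IsFiniteMeasure (measure u)
  measurable_fn : ∀ c, Measurable (fn c)
  bounded_fn : ∀ c, ∃ C, ∀ x, |fn c x| ≤ C
  op_symm : ∀ c u v, ⟪op c u, v⟫ = ⟪u, op c v⟫
  exists_mul : ∀ c d, ∃ e, fn e = fn c * fn d ∧ op e = op c * op d
  inner_op_self : ∀ c u, ⟪op c u, u⟫ = ∫ x, fn c x ∂(measure u)
  measureReal_univ : ∀ u, (measure u).real univ = ‖u‖ ^ 2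
  ext_measure : ∀ m₁ m₂ : Measure X, IsFiniteMeasure m₁ → IsFiniteMeasure m₂ →
    (∀ c, ∫ x, fn c x ∂m₁ = ∫ x, fn c x ∂m₂) → m₁ = m₂

namespace FunctionalCalculus

variable {X M H : Type*} [MeasurableSpace X] [AddCommGroup M] [Module ℝ M]
  [NormedAddCommGroup H] [InnerProductSpace ℝ H] (Φ : FunctionalCalculus X M H)

instance (u : H) : IsFiniteMeasure (Φ.measure u) := Φ.isFiniteMeasure u

theorem memLp_fn (c : M) (p : ℝ≥0∞) (ν : Measure X) [IsFiniteMeasure ν] :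
    MemLp (Φ.fn c) p ν := by
  obtain ⟨C, hC⟩ := Φ.bounded_fn c
  exact MemLp.of_bound (Φ.measurable_fn c).aestronglyMeasurable C (ae_of_all _ hC)

theorem integrable_fn (c : M) (ν : Measure X) [IsFiniteMeasure ν] : Integrable (Φ.fn c) ν :=
  memLp_one_iff_integrable.1 (Φ.memLp_fn c 1 ν)

theorem norm_op_sq (c : M) (u : H) : ‖Φ.op c u‖ ^ 2 = ∫ x, Φ.fn c x ^ 2 ∂(Φ.measure u) := by
  obtain ⟨e, he, he'⟩ := Φ.exists_mul c c
  rw [← real_inner_self_eq_norm_sq, Φ.op_symm, real_inner_comm]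
  have := Φ.inner_op_self e u
  rw [he, he'] at this
  simpa [pow_two] using this

/-- A square integrable function that is orthogonal to all `fn c` vanishes: its positive and
negative parts are densities of two measures that `fn` does not distinguish. -/
theorem ae_eq_zero_of_orthogonal (ν : Measure X) [IsFiniteMeasure ν] {g : X → ℝ}
    (hg : Integrable g ν) (h : ∀ c, ∫ x, Φ.fn c x * g x ∂ν = 0) : g =ᵐ[ν] 0 := by
  wlog hgm : Measurable g generalizing g
  · have e := hg.1.aemeasurable.ae_eq_mk
    refine e.trans (this (hg.congr e) (fun c => ?_) hg.1.aemeasurable.measurable_mk)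
    rw [← h c]
    exact integral_congr_ae (e.mono fun x hx => by simp only [hx])
  have fin : ∀ k : X → ℝ, Integrable k ν →
      IsFiniteMeasure (ν.withDensity fun x => ENNReal.ofReal (k x)) := fun k hk =>
    isFiniteMeasure_withDensity_ofReal hk.2
  have key := Φ.ext_measure (ν.withDensity fun x => ENNReal.ofReal (g x))
    (ν.withDensity fun x => ENNReal.ofReal (-g x)) (fin g hg) (fin (-g) hg.neg) (fun c => by
      rw [integral_withDensity_eq_integral_toReal_smul (by fun_prop) (by simp),
        integral_withDensity_eq_integral_toReal_smul (by fun_prop) (by simp),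
        ← sub_eq_zero, ← integral_sub, ← h c]
      · refine integral_congr_ae (ae_of_all _ fun x => ?_)
        simp only [ENNReal.toReal_ofReal', smul_eq_mul, ← sub_mul]
        rw [mul_comm, max_zero_sub_eq_self]
      · obtain ⟨C, hC⟩ := Φ.bounded_fn c
        simp only [ENNReal.toReal_ofReal']
        exact hg.pos_part.mul_bdd (Φ.measurable_fn c).aestronglyMeasurable (ae_of_all _ hC)
      · obtain ⟨C, hC⟩ := Φ.bounded_fn c
        simp only [ENNReal.toReal_ofReal']
        exact hg.neg_part.mul_bdd (Φ.measurable_fn c).aestronglyMeasurable (ae_of_all _ hC))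
  rw [withDensity_eq_iff (by fun_prop) (by fun_prop)
    (by simpa using hg.lintegral_lt_top.ne)] at key
  filter_upwards [key] with x hx
  rcases le_total 0 (g x) with h0 | h0
  · rw [ENNReal.ofReal_of_nonpos (neg_nonpos.2 h0), ENNReal.ofReal_eq_zero] at hx
    exact le_antisymm hx h0
  · rw [ENNReal.ofReal_of_nonpos h0, eq_comm, ENNReal.ofReal_eq_zero] at hx
    exact le_antisymm h0 (by simpa using hx)

/-- The functions `fn c` as elements of `L²(ν)`. -/
def toL2 (ν : Measure X) [IsFiniteMeasure ν] : M →ₗ[ℝ] Lp ℝ 2 ν where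
  toFun c := (Φ.memLp_fn c 2 ν).toLp
  map_add' c d := by
    rw [← MemLp.toLp_add]
    exact MemLp.toLp_congr _ _ (by rw [map_add])
  map_smul' a c := by
    rw [RingHom.id_apply, ← MemLp.toLp_const_smul]
    exact MemLp.toLp_congr _ _ (by rw [map_smul])

theorem denseRange_toL2 (ν : Measure X) [IsFiniteMeasure ν] : DenseRange (Φ.toL2 ν) := by
  rw [DenseRange, ← LinearMap.coe_range, Submodule.dense_iff_topologicalClosure_eq_top,
    Submodule.topologicalClosure_eq_top_iff, Submodule.eq_bot_iff]
  intro g hg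
  rw [Lp.eq_zero_iff_ae_eq_zero]
  refine Φ.ae_eq_zero_of_orthogonal ν ((Lp.memLp g).integrable one_le_two) fun c => ?_
  have := (Submodule.mem_orthogonal _ _).1 hg _ (LinearMap.mem_range_self _ c)
  rw [L2.inner_def] at this
  rw [← this]
  refine integral_congr_ae ?_
  filter_upwards [(Φ.memLp_fn c 2 ν).coeFn_toLp] with x hx
  change _ = ⟪((Φ.memLp_fn c 2 ν).toLp : X → ℝ) x, g x⟫
  rw [hx]
  simp [mul_comm]

theorem exists_tendsto (ν : Measure X) [IsFiniteMeasure ν] {f : X → ℝ} (hf : MemLp f 2 ν) :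
    ∃ c : ℕ → M, Tendsto (fun n => eLpNorm (Φ.fn (c n) - f) 2 ν) atTop (𝓝 0) := by
  obtain ⟨x, hx, hlim⟩ := mem_closure_iff_seq_limit.1 (Φ.denseRange_toL2 ν hf.toLp)
  choose c hc using hx
  refine ⟨c, ?_⟩
  rw [← Lp.tendsto_Lp_iff_tendsto_eLpNorm'' _ (fun n => Φ.memLp_fn (c n) 2 ν) f hf]
  convert! hlim using 2 with n
  exact hc n

theorem norm_toL2 (c : M) (u : H) : ‖Φ.toL2 (Φ.measure u) c‖ = ‖Φ.op c u‖ := by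
  rw [← sq_eq_sq₀ (norm_nonneg _) (norm_nonneg _), Φ.norm_op_sq, ← real_inner_self_eq_norm_sq,
    L2.inner_def]
  refine integral_congr_ae ?_
  filter_upwards [(Φ.memLp_fn c 2 (Φ.measure u)).coeFn_toLp] with x hx
  rw [toL2, LinearMap.coe_mk, AddHom.coe_mk, hx]
  simp

theorem measure_smul (a : ℝ) (u : H) :
    Φ.measure (a • u) = ENNReal.ofReal (a ^ 2) • Φ.measure u := by
  refine Φ.ext_measure _ _ inferInstance (Measure.smul_finite _ ENNReal.ofReal_ne_top) fun c => ?_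
  rw [integral_smul_measure, ← Φ.inner_op_self, ← Φ.inner_op_self, map_smul,
    real_inner_smul_left, real_inner_smul_right, ENNReal.toReal_ofReal (sq_nonneg a), smul_eq_mul]
  ring

/-- The parallelogram law for the measures. -/
theorem measure_add_add_measure_sub (u v : H) : Φ.measure (u + v) + Φ.measure (u - v) =
    (2 : ℝ≥0∞) • (Φ.measure u + Φ.measure v) := by
  refine Φ.ext_measure _ _ inferInstance (Measure.smul_finite _ ENNReal.ofNat_ne_top) fun c => ?_
  rw [integral_smul_measure, integral_add_measure (Φ.integrable_fn _ _) (Φ.integrable_fn _ _),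
    integral_add_measure (Φ.integrable_fn _ _) (Φ.integrable_fn _ _)]
  simp only [← Φ.inner_op_self, map_add, map_sub, inner_add_left, inner_add_right, inner_sub_left,
    inner_sub_right, ENNReal.toReal_ofNat, smul_eq_mul]
  ring

theorem memLp_one (u : H) : MemLp (1 : X → ℝ) 2 (Φ.measure u) :=
  memLp_of_bounded (C := 1) measurable_one (by simp) _ _

theorem memLp_smul {u : H} {f : X → ℝ} (a : ℝ) (hu : MemLp f 2 (Φ.measure u)) :
    MemLp f 2 (Φ.measure (a • u)) := by
  rw [Φ.measure_smul]
  exact hu.smul_measure ENNReal.ofReal_ne_top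

theorem memLp_add {u v : H} {f : X → ℝ} (hu : MemLp f 2 (Φ.measure u))
    (hv : MemLp f 2 (Φ.measure v)) :
    MemLp f 2 (Φ.measure (u + v)) := by
  have : MemLp f 2 (Φ.measure (u + v) + Φ.measure (u - v)) := by
    rw [Φ.measure_add_add_measure_sub]
    exact (memLp_two_add_measure.2 ⟨hu, hv⟩).smul_measure ENNReal.ofNat_ne_top
  exact (memLp_two_add_measure.1 this).1

variable [CompleteSpace H]

/-- The isometry from `L²(measure u)` to `H` that sends `fn c` to `op c u`. -/
def toHilbert (u : H) : Lp ℝ 2 (Φ.measure u) →ₗᵢ[ℝ] H where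
  toLinearMap := ((ContinuousLinearMap.apply ℝ H u).toLinearMap ∘ₗ Φ.op).extendOfNorm
    (Φ.toL2 (Φ.measure u))
  norm_map' := by
    refine (Φ.denseRange_toL2 (Φ.measure u)).induction ?_
      (isClosed_eq (by simp only [ContinuousLinearMap.coe_coe]; fun_prop) continuous_norm)
    rintro _ ⟨c, rfl⟩
    rw [ContinuousLinearMap.coe_coe, LinearMap.extendOfNorm_eq (Φ.denseRange_toL2 _)
      ⟨1, fun c => by simp [norm_toL2]⟩]
    simp [norm_toL2]

theorem toHilbert_toL2 (u : H) (c : M) : Φ.toHilbert u (Φ.toL2 _ c) = Φ.op c u :=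
  LinearMap.extendOfNorm_eq (Φ.denseRange_toL2 _) ⟨1, fun c => by simp [norm_toL2]⟩ c

open Classical in
/-- The vector `f(T) u`, for `T` the operator underlying the functional calculus and `f` square
integrable with respect to `measure u`; it is `0` for other functions `f`. -/
def int (u : H) (f : X → ℝ) : H :=
  if hf : MemLp f 2 (Φ.measure u) then Φ.toHilbert u hf.toLp else 0

variable {Φ} {u v : H} {f g : X → ℝ}

theorem int_of_memLp (hf : MemLp f 2 (Φ.measure u)) : Φ.int u f = Φ.toHilbert u hf.toLp :=
  dif_pos hf

theorem int_fn (u : H) (c : M) : Φ.int u (Φ.fn c) = Φ.op c u := by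
  rw [int_of_memLp (Φ.memLp_fn c 2 _), ← toHilbert_toL2]
  rfl

theorem int_congr (h : f =ᵐ[Φ.measure u] g) : Φ.int u f = Φ.int u g := by
  by_cases hf : MemLp f 2 (Φ.measure u)
  · have hg := hf.ae_eq h
    rw [int_of_memLp hf, int_of_memLp hg, MemLp.toLp_congr hf hg h]
  · have hg : ¬ MemLp g 2 (Φ.measure u) := fun hg => hf (hg.ae_eq h.symm)
    rw [int, int, dif_neg hf, dif_neg hg]

theorem inner_int_int (hf : MemLp f 2 (Φ.measure u)) (hg : MemLp g 2 (Φ.measure u)) :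
    ⟪Φ.int u f, Φ.int u g⟫ = ∫ x, f x * g x ∂(Φ.measure u) := by
  rw [int_of_memLp hf, int_of_memLp hg, LinearIsometry.inner_map_map, L2.inner_def]
  refine integral_congr_ae ?_
  filter_upwards [hf.coeFn_toLp, hg.coeFn_toLp] with x h1 h2
  simp [h1, h2, mul_comm]

theorem norm_int_sq (hf : MemLp f 2 (Φ.measure u)) :
    ‖Φ.int u f‖ ^ 2 = ∫ x, f x ^ 2 ∂(Φ.measure u) := by
  rw [← real_inner_self_eq_norm_sq, inner_int_int hf hf]
  simp only [pow_two]

theorem int_sub_fun (hf : MemLp f 2 (Φ.measure u)) (hg : MemLp g 2 (Φ.measure u)) :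
    Φ.int u (f - g) = Φ.int u f - Φ.int u g := by
  rw [int_of_memLp hf, int_of_memLp hg, int_of_memLp (hf.sub hg), MemLp.toLp_sub, map_sub]

theorem tendsto_int {ι : Type*} {l : Filter ι} {F : ι → X → ℝ}
    (hF : ∀ i, MemLp (F i) 2 (Φ.measure u)) (hf : MemLp f 2 (Φ.measure u))
    (h : Tendsto (fun i => eLpNorm (F i - f) 2 (Φ.measure u)) l (𝓝 0)) :
    Tendsto (fun i => Φ.int u (F i)) l (𝓝 (Φ.int u f)) := by
  rw [← Lp.tendsto_Lp_iff_tendsto_eLpNorm'' _ hF f hf] at h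
  have := ((Φ.toHilbert u).continuous.tendsto _).comp h
  rw [int_of_memLp hf]
  refine this.congr fun i => ?_
  rw [int_of_memLp (hF i)]
  rfl

theorem tendsto_op {c : ℕ → M} (hf : MemLp f 2 (Φ.measure u))
    (h : Tendsto (fun n => eLpNorm (Φ.fn (c n) - f) 2 (Φ.measure u)) atTop (𝓝 0)) :
    Tendsto (fun n => Φ.op (c n) u) atTop (𝓝 (Φ.int u f)) := by
  simp only [← int_fn]
  exact tendsto_int (fun n => Φ.memLp_fn _ _ _) hf h

/-- One sequence of functions `fn (c n)` approximates `f` for several vectors at once. -/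
theorem exists_tendsto_op (S : Finset H) (hf : ∀ u ∈ S, MemLp f 2 (Φ.measure u)) :
    ∃ c : ℕ → M, ∀ u ∈ S, Tendsto (fun n => eLpNorm (Φ.fn (c n) - f) 2 (Φ.measure u)) atTop (𝓝 0) ∧
      Tendsto (fun n => Φ.op (c n) u) atTop (𝓝 (Φ.int u f)) := by
  have hν : MemLp f 2 (∑ u ∈ S, Φ.measure u) := by
    classical
    induction S using Finset.induction_on with
    | empty => simp
    | insert a S ha ih =>
      rw [Finset.sum_insert ha]
      exact memLp_two_add_measure.2 ⟨hf a (by simp), ih fun u hu => hf u (by simp [hu])⟩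
  obtain ⟨c, hc⟩ := Φ.exists_tendsto _ hν
  refine ⟨c, fun u hu => ?_⟩
  have : Tendsto (fun n => eLpNorm (Φ.fn (c n) - f) 2 (Φ.measure u)) atTop (𝓝 0) :=
    tendsto_of_tendsto_of_tendsto_of_le_of_le tendsto_const_nhds hc (fun _ => zero_le)
      fun n => eLpNorm_mono_measure _ (Finset.single_le_sum (f := fun u => Φ.measure u)
        (fun _ _ => Measure.zero_le _) hu)
  exact ⟨this, tendsto_op (hf u hu) this⟩

theorem int_add (hu : MemLp f 2 (Φ.measure u)) (hv : MemLp f 2 (Φ.measure v))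
    (huv : MemLp f 2 (Φ.measure (u + v))) : Φ.int (u + v) f = Φ.int u f + Φ.int v f := by
  classical
  obtain ⟨c, hc⟩ := exists_tendsto_op (Φ := Φ) (f := f) {u, v, u + v} (by simp [hu, hv, huv])
  refine tendsto_nhds_unique (hc (u + v) (by simp)).2 ?_
  simp only [map_add]
  exact (hc u (by simp)).2.add (hc v (by simp)).2

theorem inner_int_symm (hu : MemLp f 2 (Φ.measure u)) (hv : MemLp f 2 (Φ.measure v)) :
    ⟪Φ.int u f, v⟫ = ⟪u, Φ.int v f⟫ := by
  classical
  obtain ⟨c, hc⟩ := exists_tendsto_op (Φ := Φ) (f := f) {u, v} (by simp [hu, hv])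
  refine tendsto_nhds_unique ((hc u (by simp)).2.inner tendsto_const_nhds) ?_
  simp only [Φ.op_symm]
  exact tendsto_const_nhds.inner (hc v (by simp)).2

theorem int_smul (a : ℝ) (hu : MemLp f 2 (Φ.measure u)) : Φ.int (a • u) f = a • Φ.int u f := by
  classical
  obtain ⟨c, hc⟩ := exists_tendsto_op (Φ := Φ) (f := f) {u, a • u} (by simp [hu, Φ.memLp_smul a hu])
  refine tendsto_nhds_unique (hc (a • u) (by simp)).2 ?_
  simp only [map_smul]
  exact (hc u (by simp)).2.const_smul a

theorem inner_int_self (hf : MemLp f 2 (Φ.measure u)) :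
    ⟪Φ.int u f, u⟫ = ∫ x, f x ∂(Φ.measure u) := by
  classical
  obtain ⟨c, hc⟩ := exists_tendsto_op (Φ := Φ) (f := f) {u} (by simp [hf])
  refine tendsto_nhds_unique ((hc u (by simp)).2.inner tendsto_const_nhds) ?_
  simp only [Φ.inner_op_self]
  refine tendsto_integral_of_L1' f (hf.integrable one_le_two).1
    (.of_forall fun n => Φ.integrable_fn _ _) ?_
  have h := ENNReal.Tendsto.mul_const (hc u (by simp)).1
    (b := (Φ.measure u) univ ^ (1 / (1 : ℝ≥0∞).toReal - 1 / (2 : ℝ≥0∞).toReal))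
    (.inr (ENNReal.rpow_ne_top_of_nonneg (by norm_num) (measure_ne_top _ _)))
  rw [zero_mul] at h
  exact tendsto_of_tendsto_of_tendsto_of_le_of_le tendsto_const_nhds h (fun _ => zero_le)
    fun n => eLpNorm_le_eLpNorm_mul_rpow_measure_univ one_le_two
      (((Φ.memLp_fn _ 2 _).sub hf).1)

/-- The constant `1` need not be one of the functions `fn c`; that it acts as the identity follows
from the total mass of the measures. -/
theorem int_one (u : H) : Φ.int u 1 = u := by
  rw [← sub_eq_zero, ← norm_eq_zero, ← sq_eq_zero_iff, norm_sub_sq_real,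
    norm_int_sq (Φ.memLp_one u), inner_int_self (Φ.memLp_one u)]
  simp [Φ.measureReal_univ]
  ring

theorem op_int (c : M) (hf : MemLp f 2 (Φ.measure u)) :
    Φ.op c (Φ.int u f) = Φ.int u (Φ.fn c * f) := by
  classical
  obtain ⟨C, hC⟩ := Φ.bounded_fn c
  have hcb : ∀ k : X → ℝ, ∀ᵐ x ∂(Φ.measure u), ‖(Φ.fn c * k) x‖ ≤ C * ‖k x‖ := fun k =>
    ae_of_all _ fun x => by
      rw [Pi.mul_apply, norm_mul]
      exact mul_le_mul_of_nonneg_right (hC x) (norm_nonneg _)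
  have hcf : ∀ k, MemLp k 2 (Φ.measure u) → MemLp (Φ.fn c * k) 2 (Φ.measure u) := fun k hk =>
    hk.of_le_mul ((Φ.measurable_fn c).aestronglyMeasurable.mul hk.1) (hcb k)
  obtain ⟨d, hd⟩ := exists_tendsto_op (Φ := Φ) (f := f) {u} (by simp [hf])
  obtain ⟨h1, h2⟩ := hd u (by simp)
  refine tendsto_nhds_unique (((Φ.op c).continuous.tendsto _).comp h2) ?_
  have h3 : Tendsto (fun n => eLpNorm (Φ.fn c * Φ.fn (d n) - Φ.fn c * f) 2 (Φ.measure u)) atTop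
      (𝓝 0) := by
    have h := ENNReal.Tendsto.const_mul h1 (a := ENNReal.ofReal C) (.inr ENNReal.ofReal_ne_top)
    rw [mul_zero] at h
    refine tendsto_of_tendsto_of_tendsto_of_le_of_le tendsto_const_nhds h (fun _ => zero_le)
      fun n => ?_
    rw [← mul_sub]
    exact eLpNorm_le_mul_eLpNorm_of_ae_le_mul (hcb _) 2
  refine (tendsto_int (fun n => hcf _ (Φ.memLp_fn _ _ _)) (hcf f hf) h3).congr fun n => ?_
  obtain ⟨e, he, he'⟩ := Φ.exists_mul c (d n)
  rw [← he, int_fn, he']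
  rfl

/-- The spectral measure of `f(T) u` has density `f ^ 2` with respect to that of `u`. -/
theorem measure_int (hfm : Measurable f) (hf : MemLp f 2 (Φ.measure u)) :
    Φ.measure (Φ.int u f) = (Φ.measure u).withDensity fun x => ENNReal.ofReal (f x ^ 2) := by
  have hsq := hf.integrable_sq
  refine Φ.ext_measure _ _ inferInstance (isFiniteMeasure_withDensity_ofReal hsq.2) fun c => ?_
  have hcf : MemLp (Φ.fn c * f) 2 (Φ.measure u) := by
    obtain ⟨C, hC⟩ := Φ.bounded_fn c
    refine hf.of_le_mul (c := C) ((Φ.measurable_fn c).aestronglyMeasurable.mul hf.1)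
      (ae_of_all _ fun x => ?_)
    rw [Pi.mul_apply, norm_mul]
    exact mul_le_mul_of_nonneg_right (hC x) (norm_nonneg _)
  rw [integral_withDensity_eq_integral_toReal_smul (by fun_prop) (by simp), ← Φ.inner_op_self,
    op_int c hf, inner_int_int hcf hf]
  refine integral_congr_ae (ae_of_all _ fun x => ?_)
  simp only [ENNReal.toReal_ofReal (sq_nonneg _), smul_eq_mul, Pi.mul_apply]
  ring

theorem eLpNorm_int (hgm : Measurable g) (hg : MemLp g 2 (Φ.measure u)) (f : X → ℝ) :
    eLpNorm f 2 (Φ.measure (Φ.int u g)) = eLpNorm (f * g) 2 (Φ.measure u) := by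
  rw [measure_int hgm hg, eLpNorm_eq_lintegral_rpow_enorm_toReal two_ne_zero ENNReal.ofNat_ne_top,
    eLpNorm_eq_lintegral_rpow_enorm_toReal two_ne_zero ENNReal.ofNat_ne_top,
    lintegral_withDensity_eq_lintegral_mul_non_measurable _ (by fun_prop) (by simp)]
  congr 1
  refine lintegral_congr fun x => ?_
  simp only [Pi.mul_apply, ENNReal.toReal_ofNat, enorm_mul, ENNReal.rpow_ofNat, mul_pow]
  rw [mul_comm, ← ofReal_norm (g x), ← ENNReal.ofReal_pow (norm_nonneg _), Real.norm_eq_abs,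
    sq_abs]

theorem memLp_int_iff (hfm : Measurable f) (hgm : Measurable g) (hg : MemLp g 2 (Φ.measure u)) :
    MemLp f 2 (Φ.measure (Φ.int u g)) ↔ MemLp (f * g) 2 (Φ.measure u) := by
  rw [MemLp, MemLp, eLpNorm_int hgm hg]
  simp only [hfm.aestronglyMeasurable, (hfm.mul hgm).aestronglyMeasurable, true_and]

/-- Multiplicativity of the calculus. Only the integrability of `f * g` is required, so that `f`
may be unbounded. -/
theorem int_int (hfm : Measurable f) (hgm : Measurable g) (hg : MemLp g 2 (Φ.measure u))
    (hfg : MemLp (f * g) 2 (Φ.measure u)) : Φ.int (Φ.int u g) f = Φ.int u (f * g) := by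
  have hf := (memLp_int_iff hfm hgm hg).2 hfg
  obtain ⟨c, hc⟩ := exists_tendsto_op (Φ := Φ) (f := f) {Φ.int u g} (by simpa using hf)
  obtain ⟨h1, h2⟩ := hc (Φ.int u g) (by simp)
  refine tendsto_nhds_unique h2 ?_
  simp only [op_int _ hg]
  refine tendsto_int (fun n => ?_) hfg ?_
  · rw [← memLp_int_iff (Φ.measurable_fn _) hgm hg]
    exact Φ.memLp_fn _ _ _
  · simpa only [eLpNorm_int hgm hg, sub_mul] using h1

end FunctionalCalculus

/-! ### Spectral projections of a functional calculus -/

namespace FunctionalCalculus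

theorem abs_indicator_one_le {X : Type*} (s : Set X) (x : X) : |s.indicator (1 : X → ℝ) x| ≤ 1 := by
  by_cases h : x ∈ s <;> simp [h]

variable {X M H : Type*} [MeasurableSpace X] [AddCommGroup M] [Module ℝ M]
  [NormedAddCommGroup H] [InnerProductSpace ℝ H] {Φ : FunctionalCalculus X M H}

theorem memLp_indicator {s : Set X} (hs : MeasurableSet s) (u : H) :
    MemLp (s.indicator (1 : X → ℝ)) 2 (Φ.measure u) :=
  memLp_of_bounded (measurable_one.indicator hs) (abs_indicator_one_le s) _ _

variable [CompleteSpace H]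

theorem tendsto_int_of_bounded {ι : Type*} {l : Filter ι} [l.IsCountablyGenerated] {u : H}
    {F : ι → X → ℝ} {f : X → ℝ} {C : ℝ} (hF : ∀ i, Measurable (F i)) (hFC : ∀ i x, |F i x| ≤ C)
    (hf : Measurable f) (hfC : ∀ x, |f x| ≤ C) (h : ∀ x, Tendsto (fun i => F i x) l (𝓝 (f x))) :
    Tendsto (fun i => Φ.int u (F i)) l (𝓝 (Φ.int u f)) := by
  have mF := fun i => memLp_of_bounded (hF i) (hFC i) 2 (Φ.measure u)
  have mf := memLp_of_bounded hf hfC 2 (Φ.measure u)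
  have key : Tendsto (fun i => ∫ x, (F i - f) x ^ 2 ∂(Φ.measure u)) l
      (𝓝 (∫ _, 0 ∂(Φ.measure u))) := by
    refine tendsto_integral_filter_of_dominated_convergence (fun _ => (2 * C) ^ 2)
      (.of_forall fun i => (((hF i).sub hf).pow_const 2).aestronglyMeasurable)
      (.of_forall fun i => ae_of_all _ fun x => ?_) (integrable_const _) (ae_of_all _ fun x => ?_)
    · rw [norm_pow, Real.norm_eq_abs]
      refine pow_le_pow_left₀ (abs_nonneg _) ?_ 2
      exact (abs_sub _ _).trans (by linarith [hFC i x, hfC x])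
    · simpa using ((h x).sub_const (f x)).pow 2
  rw [tendsto_iff_norm_sub_tendsto_zero]
  have h2 : ∀ i, ‖Φ.int u (F i) - Φ.int u f‖ = √(∫ x, (F i - f) x ^ 2 ∂(Φ.measure u)) := fun i => by
    rw [← int_sub_fun (mF i) mf, ← norm_int_sq ((mF i).sub mf), Real.sqrt_sq (norm_nonneg _)]
  simp only [h2]
  simpa using key.sqrt

theorem norm_int_indicator_sq {s : Set X} (hs : MeasurableSet s) (u : H) :
    ‖Φ.int u (s.indicator 1)‖ ^ 2 = (Φ.measure u).real s := by
  rw [norm_int_sq (memLp_indicator hs u), ← integral_indicator_one hs]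
  refine integral_congr_ae (ae_of_all _ fun x => ?_)
  by_cases h : x ∈ s <;> simp [h]

variable (Φ) in
/-- The spectral projection of a measurable set. -/
def proj (s : Set X) (hs : MeasurableSet s) : H →L[ℝ] H :=
  LinearMap.mkContinuous
    { toFun := fun u => Φ.int u (s.indicator 1)
      map_add' := fun u v =>
        int_add (memLp_indicator hs u) (memLp_indicator hs v) (memLp_indicator hs _)
      map_smul' := fun a u => int_smul a (memLp_indicator hs u) } 1 fun u => by
    rw [one_mul, ← sq_le_sq₀ (norm_nonneg _) (norm_nonneg _), ← Φ.measureReal_univ u]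
    exact (norm_int_indicator_sq hs u).trans_le (measureReal_mono (subset_univ s))

theorem proj_mul_proj {s t : Set X} (hs : MeasurableSet s) (ht : MeasurableSet t) :
    Φ.proj s hs * Φ.proj t ht = Φ.proj (s ∩ t) (hs.inter ht) := by
  ext u
  change Φ.int (Φ.int u _) _ = Φ.int u _
  have e : s.indicator (1 : X → ℝ) * t.indicator 1 = (s ∩ t).indicator 1 := by
    rw [inter_indicator_one]
  rw [int_int (measurable_one.indicator hs) (measurable_one.indicator ht) (memLp_indicator ht u)
    (e ▸ memLp_indicator (hs.inter ht) u), e]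

theorem isStarProjection_proj {s : Set X} (hs : MeasurableSet s) :
    IsStarProjection (Φ.proj s hs) where
  isIdempotentElem := by
    rw [IsIdempotentElem, proj_mul_proj]
    simp only [inter_self]
  isSelfAdjoint := ContinuousLinearMap.isSelfAdjoint_iff_isSymmetric.2 fun u v =>
    inner_int_symm (memLp_indicator hs u) (memLp_indicator hs v)

variable (Φ) in
/-- The spectral family of the operator `θ(T)`, where `T` is the operator underlying the functional
calculus: the projection with parameter `t` is the spectral projection of `{θ ≤ t}`. -/
def spectralFamily (θ : X → ℝ) (hθ : Measurable θ) : SpectralFamily H where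
  proj t := Φ.proj (θ ⁻¹' Iic t) (hθ measurableSet_Iic)
  isStarProjection _ := isStarProjection_proj _
  mul_of_le t t' h := by
    rw [proj_mul_proj]
    congr 1
    exact inter_eq_right.2 (preimage_mono (Iic_subset_Iic.2 h))
  right_cont u t := by
    refine tendsto_int_of_bounded (C := 1)
      (fun t' => measurable_one.indicator (hθ measurableSet_Iic)) (fun t' => abs_indicator_one_le _)
      (measurable_one.indicator (hθ measurableSet_Iic))
      (abs_indicator_one_le _) fun x => ?_
    rcases le_or_gt (θ x) t with h | h
    · refine tendsto_const_nhds.congr' ?_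
      filter_upwards [self_mem_nhdsWithin] with t' ht'
      rw [indicator_of_mem (show x ∈ θ ⁻¹' Iic t from h),
        indicator_of_mem (show x ∈ θ ⁻¹' Iic t' from h.trans ht')]
    · refine tendsto_const_nhds.congr' ?_
      filter_upwards [mem_nhdsWithin_of_mem_nhds (Iio_mem_nhds h)] with t' ht'
      rw [indicator_of_notMem (s := θ ⁻¹' Iic t) (not_le.2 h : ¬ θ x ≤ t),
        indicator_of_notMem (s := θ ⁻¹' Iic t') (not_le.2 ht' : ¬ θ x ≤ t')]
  tendsto_atBot u := by
    have h0 : Φ.int u 0 = 0 := by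
      rw [← norm_eq_zero, ← sq_eq_zero_iff, norm_int_sq MemLp.zero]
      simp
    rw [← h0]
    refine tendsto_int_of_bounded (C := 1)
      (fun t' => measurable_one.indicator (hθ measurableSet_Iic)) (fun t' => abs_indicator_one_le _)
      measurable_zero (by simp) fun x => ?_
    refine tendsto_const_nhds.congr' ?_
    filter_upwards [Iio_mem_atBot (θ x)] with t ht
    rw [indicator_of_notMem (s := θ ⁻¹' Iic t) (not_le.2 ht : ¬ θ x ≤ t), Pi.zero_apply]
  tendsto_atTop u := by
    nth_rw 2 [← Φ.int_one u]
    refine tendsto_int_of_bounded (C := 1)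
      (fun t' => measurable_one.indicator (hθ measurableSet_Iic)) (fun t' => abs_indicator_one_le _)
      measurable_one (by simp) fun x => ?_
    refine tendsto_const_nhds.congr' ?_
    filter_upwards [Ici_mem_atTop (θ x)] with t ht
    rw [indicator_of_mem (show x ∈ θ ⁻¹' Iic t from ht)]

end FunctionalCalculus

/-! ### The functional calculus of a spectral family -/

namespace SpectralFamily

variable {H : Type*} [NormedAddCommGroup H] [InnerProductSpace ℝ H] [CompleteSpace H]
  (E : SpectralFamily H)

theorem tendsto_distribution_atBot (u : H) : Tendsto (E.distribution u) atBot (𝓝 0) := by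
  rw [← inner_zero_left (𝕜 := ℝ) u]
  exact (E.tendsto_atBot u).inner (tendsto_const_nhds (x := u))

theorem tendsto_distribution_atTop (u : H) : Tendsto (E.distribution u) atTop (𝓝 (‖u‖ ^ 2)) := by
  rw [← real_inner_self_eq_norm_sq]
  exact (E.tendsto_atTop u).inner (tendsto_const_nhds (x := u))

theorem measure_Iic (u : H) (t : ℝ) : E.measure u (Iic t) = ENNReal.ofReal ⟪E.proj t u, u⟫ := by
  rw [measure, StieltjesFunction.measure_Iic _ (E.tendsto_distribution_atBot u), sub_zero]
  rfl

theorem measure_univ (u : H) : E.measure u univ = ENNReal.ofReal (‖u‖ ^ 2) := by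
  rw [measure, StieltjesFunction.measure_univ _ (E.tendsto_distribution_atBot u)
    (E.tendsto_distribution_atTop u), sub_zero]

instance (u : H) : IsFiniteMeasure (E.measure u) := ⟨by simp [E.measure_univ]⟩

theorem inner_proj_symm (t : ℝ) (u v : H) : ⟪E.proj t u, v⟫ = ⟪u, E.proj t v⟫ :=
  ContinuousLinearMap.isSelfAdjoint_iff_isSymmetric.1 (E.isStarProjection t).isSelfAdjoint u v

theorem proj_mul_proj (s t : ℝ) : E.proj s * E.proj t = E.proj (min s t) := by
  rcases le_total t s with h | h
  · rw [min_eq_right h, E.mul_of_le t s h]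
  · have := congrArg star (E.mul_of_le s t h)
    rw [star_mul, (E.isStarProjection s).isSelfAdjoint.star_eq,
      (E.isStarProjection t).isSelfAdjoint.star_eq] at this
    rw [min_eq_left h, this]

theorem inner_proj_nonneg (t : ℝ) (u : H) : 0 ≤ ⟪E.proj t u, u⟫ := by
  have h := E.proj_mul_proj t t
  rw [min_self] at h
  rw [← h, mul_apply_eq_comp, inner_proj_symm]
  exact real_inner_self_nonneg

/-- The calculus of a spectral family on right-closed step functions: the function `1_{(-∞, t]}`
corresponds to the projection `E_t`. -/
def calculus : FunctionalCalculus ℝ (ℝ →₀ ℝ) H where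
  fn := Finsupp.linearCombination ℝ fun t => (Iic t).indicator 1
  op := Finsupp.linearCombination ℝ E.proj
  measure := E.measure
  isFiniteMeasure _ := inferInstance
  measurable_fn c := by
    induction c using Finsupp.induction_linear with
    | zero => rw [map_zero]; exact measurable_zero
    | add c d hc hd => rw [map_add]; exact hc.add hd
    | single t a =>
      rw [Finsupp.linearCombination_single]
      exact (measurable_one.indicator measurableSet_Iic).const_smul a
  bounded_fn c := by
    induction c using Finsupp.induction_linear with
    | zero => exact ⟨0, by simp⟩
    | add c d hc hd =>
      obtain ⟨C, hC⟩ := hc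
      obtain ⟨D, hD⟩ := hd
      refine ⟨C + D, fun x => ?_⟩
      rw [map_add]
      exact (abs_add_le _ _).trans (add_le_add (hC x) (hD x))
    | single t a =>
      refine ⟨|a|, fun x => ?_⟩
      rw [Finsupp.linearCombination_single, Pi.smul_apply, smul_eq_mul, abs_mul]
      exact mul_le_of_le_one_right (abs_nonneg a) (FunctionalCalculus.abs_indicator_one_le _ x)
  op_symm c u v := by
    induction c using Finsupp.induction_linear with
    | zero => simp
    | add c d hc hd => simp [inner_add_left, inner_add_right, hc, hd]
    | single t a => simp [real_inner_smul_left, real_inner_smul_right, inner_proj_symm]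
  exists_mul c d := by
    induction c using Finsupp.induction_linear with
    | zero => exact ⟨0, by simp⟩
    | add c c' hc hc' =>
      obtain ⟨e, h1, h2⟩ := hc
      obtain ⟨e', h1', h2'⟩ := hc'
      exact ⟨e + e', by simp only [map_add, h1, h1', add_mul], by
        simp only [map_add, h2, h2', add_mul]⟩
    | single t a =>
      induction d using Finsupp.induction_linear with
      | zero => exact ⟨0, by simp⟩
      | add c c' hc hc' =>
        obtain ⟨e, h1, h2⟩ := hc
        obtain ⟨e', h1', h2'⟩ := hc'
        exact ⟨e + e', by simp only [map_add, h1, h1', mul_add], by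
          simp only [map_add, h2, h2', mul_add]⟩
      | single s b =>
        refine ⟨Finsupp.single (min t s) (a * b), ?_, ?_⟩
        · simp only [Finsupp.linearCombination_single, ← Iic_inter_Iic, inter_indicator_one]
          rw [smul_mul_smul_comm]
        · simp only [Finsupp.linearCombination_single, ← proj_mul_proj]
          rw [smul_mul_smul_comm]
  inner_op_self c u := by
    have hi : ∀ t : ℝ, Integrable ((Iic t).indicator (1 : ℝ → ℝ)) (E.measure u) := fun t =>
      (integrable_const (1 : ℝ)).indicator measurableSet_Iic
    suffices h : Integrable (Finsupp.linearCombination ℝ (fun t : ℝ => (Iic t).indicator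
        (1 : ℝ → ℝ)) c) (E.measure u) ∧ ⟪Finsupp.linearCombination ℝ E.proj c u, u⟫ =
        ∫ x, Finsupp.linearCombination ℝ (fun t : ℝ => (Iic t).indicator (1 : ℝ → ℝ)) c x
          ∂(E.measure u) from h.2
    induction c using Finsupp.induction_linear with
    | zero => simp
    | add c d hc hd =>
      simp only [map_add]
      refine ⟨hc.1.add hd.1, ?_⟩
      rw [integral_add' hc.1 hd.1, ← hc.2, ← hd.2, add_apply, inner_add_left]
    | single t a =>
      simp only [Finsupp.linearCombination_single]
      refine ⟨(hi t).smul a, ?_⟩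
      simp only [Pi.smul_apply]
      rw [integral_smul, integral_indicator_one measurableSet_Iic, Measure.real, measure_Iic,
        ENNReal.toReal_ofReal (E.inner_proj_nonneg t u), smul_apply,
        real_inner_smul_left, smul_eq_mul]
  measureReal_univ u := by
    rw [Measure.real, measure_univ, ENNReal.toReal_ofReal (sq_nonneg _)]
  ext_measure m₁ m₂ h₁ h₂ h := by
    refine Measure.ext_of_Iic _ _ fun t => ?_
    have := h (Finsupp.single t 1)
    simp only [Finsupp.linearCombination_single, one_smul,
      integral_indicator_one measurableSet_Iic] at this
    exact (measureReal_eq_measureReal_iff).1 this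

theorem calculus_measure (u : H) : E.calculus.measure u = E.measure u := rfl

end SpectralFamily

theorem FunctionalCalculus.spectralFamily_measure {X M H : Type*} [MeasurableSpace X]
    [AddCommGroup M] [Module ℝ M] [NormedAddCommGroup H] [InnerProductSpace ℝ H] [CompleteSpace H]
    (Φ : FunctionalCalculus X M H) {θ : X → ℝ} (hθ : Measurable θ) (u : H) :
    (Φ.spectralFamily θ hθ).measure u = (Φ.measure u).map θ := by
  refine Measure.ext_of_Iic _ _ fun t => ?_
  have hm : MeasurableSet (θ ⁻¹' Iic t) := hθ measurableSet_Iic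
  rw [SpectralFamily.measure_Iic, Measure.map_apply hθ measurableSet_Iic, ← ofReal_measureReal]
  congr 1
  change ⟪Φ.int u _, u⟫ = _
  rw [inner_int_self (memLp_indicator hm u), integral_indicator_one hm]

/-! ### Unbounded spectral integrals -/

namespace FunctionalCalculus

variable {X M H : Type*} [MeasurableSpace X] [AddCommGroup M] [Module ℝ M]
  [NormedAddCommGroup H] [InnerProductSpace ℝ H] [CompleteSpace H]
  (Φ : FunctionalCalculus X M H)

/-- The unbounded operator `f(T)`, where `T` is the operator underlying the functional calculus. -/
def integral (f : X → ℝ) : H →ₗ.[ℝ] H where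
  domain :=
    { carrier := {u | MemLp f 2 (Φ.measure u)}
      add_mem' := fun hu hv => Φ.memLp_add hu hv
      zero_mem' := by
        have h := Φ.measure_smul 0 0
        rw [smul_zero, zero_pow two_ne_zero, ENNReal.ofReal_zero, zero_smul] at h
        change MemLp f 2 _
        rw [h]
        exact ⟨aestronglyMeasurable_zero_measure f, by simp⟩
      smul_mem' := fun a _ hu => Φ.memLp_smul a hu }
  toFun :=
    { toFun := fun u => Φ.int u f
      map_add' := fun u v => int_add u.2 v.2 (Φ.memLp_add u.2 v.2)
      map_smul' := fun a u => int_smul a u.2 }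

end FunctionalCalculus

namespace SpectralFamily

open FunctionalCalculus

variable {H : Type*} [NormedAddCommGroup H] [InnerProductSpace ℝ H] [CompleteSpace H]
  {E : SpectralFamily H} {f : ℝ → ℝ} {B : H →ₗ.[ℝ] H}

variable (E f) in
theorem isIntegral_integral : E.IsIntegral f (E.calculus.integral f) where
  symm u v := inner_int_symm u.2 v.2
  mem_domain_iff _ := Iff.rfl
  inner_eq u := inner_int_self u.2

/-- The vectors whose spectral measure lives on `{|f| ≤ n}` are in the domain of `∫ f dE`, so this
domain is dense. -/
theorem IsIntegral.dense_domain (h : E.IsIntegral f B) (hf : Measurable f) :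
    Dense (B.domain : Set H) := by
  intro v
  have hs : ∀ n : ℕ, MeasurableSet {x | |f x| ≤ n} := fun n =>
    measurableSet_le hf.abs measurable_const
  have hlim : Tendsto (fun n : ℕ => E.calculus.int v ({x | |f x| ≤ n}.indicator 1)) atTop
      (𝓝 (E.calculus.int v 1)) := by
    refine tendsto_int_of_bounded (C := 1) (fun n => measurable_one.indicator (hs n))
      (fun n => abs_indicator_one_le _) measurable_one (by simp) fun x => ?_
    refine tendsto_const_nhds.congr' ?_
    filter_upwards [eventually_ge_atTop ⌈|f x|⌉₊] with n hn
    rw [indicator_of_mem (show x ∈ {x | |f x| ≤ n} from Nat.ceil_le.1 hn)]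
  rw [int_one] at hlim
  refine mem_closure_of_tendsto hlim (.of_forall fun n => (h.mem_domain_iff _).2 ?_)
  rw [← calculus_measure, memLp_int_iff hf (measurable_one.indicator (hs n))
    (memLp_indicator (hs n) v)]
  refine memLp_of_bounded (C := n) (hf.mul (measurable_one.indicator (hs n))) (fun x => ?_) _ _
  by_cases hx : |f x| ≤ n <;> simp [hx]

/-- The conditions in `IsIntegral` determine the operator, by polarization. -/
theorem IsIntegral.apply_eq (h : E.IsIntegral f B) (hf : Measurable f) (u : B.domain) :
    B u = E.calculus.int (u : H) f := by
  have mem : ∀ x : B.domain, MemLp f 2 (E.calculus.measure (x : H)) := fun x =>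
    (h.mem_domain_iff x).1 x.2
  have quad : ∀ x : B.domain, ⟪B x, (x : H)⟫ = ⟪E.calculus.int (x : H) f, (x : H)⟫ := fun x => by
    rw [h.inner_eq, inner_int_self (mem x), calculus_measure]
  refine (h.dense_domain hf).eq_of_inner_left (𝕜 := ℝ) fun w hw => ?_
  lift w to B.domain using hw
  have h1 := quad (u + w)
  rw [B.map_add, Submodule.coe_add, int_add (mem u) (mem w) (mem (u + w)), inner_add_left,
    inner_add_left, inner_add_right, inner_add_right, inner_add_right, inner_add_right,
    quad u, quad w, inner_int_symm (mem w) (mem u),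
    real_inner_comm (E.calculus.int (u : H) f) (w : H)] at h1
  have h2 : ⟪B w, (u : H)⟫ = ⟪B u, (w : H)⟫ := by
    rw [real_inner_comm, ← h.symm]
  rw [h2] at h1
  linarith

/-- The powers of `∫ f dE` are the operators `∫ f ^ n dE`, with the natural domains. -/
theorem IsIntegral.pow_spec (h : E.IsIntegral f B) (hf : Measurable f) (n : ℕ) (u : H) :
    (u ∈ (pow B n).domain ↔ MemLp (f ^ n) 2 (E.measure u)) ∧
      ∀ hu : u ∈ (pow B n).domain, pow B n ⟨u, hu⟩ = E.calculus.int u (f ^ n) := by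
  induction n with
  | zero =>
    rw [pow_zero, int_one]
    exact ⟨iff_of_true (Submodule.mem_top) (E.calculus.memLp_one u), fun _ => rfl⟩
  | succ n ih =>
    obtain ⟨ih1, ih2⟩ := ih
    have hfn : Measurable (f ^ n) := hf.pow_const n
    have hle : MemLp (f ^ (n + 1)) 2 (E.measure u) → MemLp (f ^ n) 2 (E.measure u) := fun hm => by
      refine ((E.calculus.memLp_one u).add hm.norm).of_le hfn.aestronglyMeasurable
        (ae_of_all _ fun x => ?_)
      simp only [Pi.pow_apply, Pi.add_apply, Pi.one_apply, norm_pow, Real.norm_eq_abs]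
      refine le_trans ?_ (le_abs_self _)
      rcases le_total |f x| 1 with hx | hx
      · exact (pow_le_one₀ (abs_nonneg _) hx).trans (le_add_of_nonneg_right (by positivity))
      · exact (pow_le_pow_right₀ hx n.le_succ).trans (le_add_of_nonneg_left zero_le_one)
    have hdom : u ∈ (pow B (n + 1)).domain ↔ MemLp (f ^ (n + 1)) 2 (E.measure u) := by
      rw [pow, mem_pcomp_domain]
      constructor
      · rintro ⟨h1, h2⟩
        rwa [h.mem_domain_iff, ih2 h1, ← calculus_measure, memLp_int_iff hf hfn (ih1.1 h1),
          ← pow_succ'] at h2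
      · intro hm
        have h1 := ih1.2 (hle hm)
        refine ⟨h1, ?_⟩
        rwa [h.mem_domain_iff, ih2 h1, ← calculus_measure, memLp_int_iff hf hfn (ih1.1 h1),
          ← pow_succ']
    refine ⟨hdom, fun hu => ?_⟩
    obtain ⟨h1, h2⟩ := (mem_pcomp_domain _ _ _).1 hu
    have hm := hdom.1 hu
    rw [pow_succ'] at hm ⊢
    rw [← int_int hf hfn (ih1.1 h1) hm, ← ih2 h1]
    exact (pcomp_apply _ _ _ hu h1 h2).trans (h.apply_eq hf ⟨_, h2⟩)

/-- Gevrey vectors of `∫ f dE` in terms of moments of the spectral measure. -/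
theorem IsIntegral.mem_gevrey_iff (h : E.IsIntegral f B) (hf : Measurable f) (s : ℝ) (u : H) :
    u ∈ gevrey B s ↔ ∃ R : ℝ, 0 < R ∧ ∀ n : ℕ, 1 ≤ n → MemLp (f ^ n) 2 (E.measure u) ∧
      ∫ x, (f x ^ n) ^ 2 ∂(E.measure u) ≤ (R ^ n * (n : ℝ) ^ (s * n)) ^ 2 := by
  have key : ∀ n (hn : u ∈ (pow B n).domain), ‖pow B n ⟨u, hn⟩‖ ^ 2 =
      ∫ x, (f x ^ n) ^ 2 ∂(E.measure u) := fun n hn => by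
    rw [(h.pow_spec hf n u).2, norm_int_sq ((h.pow_spec hf n u).1.1 hn)]
    rfl
  constructor
  · rintro ⟨hu, R, hR, hb⟩
    refine ⟨R, hR, fun n hn => ⟨(h.pow_spec hf n u).1.1 (hu n), ?_⟩⟩
    rw [← key n (hu n)]
    exact pow_le_pow_left₀ (norm_nonneg _) (hb n hn) 2
  · rintro ⟨R, hR, hb⟩
    have hu : ∀ n, u ∈ (pow B n).domain := fun n => by
      rcases Nat.eq_zero_or_pos n with rfl | hn
      · exact Submodule.mem_top
      · exact (h.pow_spec hf n u).1.2 (hb n hn).1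
    refine ⟨hu, R, hR, fun n hn => ?_⟩
    rw [← sq_le_sq₀ (norm_nonneg _) (by positivity), key]
    exact (hb n hn).2

/-- The spectral measures of a positive operator are carried by `[0, ∞)`. -/
theorem IsIntegral.ae_nonneg (h : E.IsIntegral (fun t => t) B)
    (hB : ∀ u : B.domain, 0 ≤ ⟪B u, (u : H)⟫) (u : H) : ∀ᵐ t ∂(E.measure u), 0 ≤ t := by
  suffices hn : ∀ n : ℕ, E.measure u (Ico (-n : ℝ) 0) = 0 by
    have : {t : ℝ | ¬ 0 ≤ t} ⊆ ⋃ n : ℕ, Ico (-n : ℝ) 0 := fun t ht => by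
      obtain ⟨n, hn⟩ := exists_nat_ge (-t)
      exact mem_iUnion.2 ⟨n, by linarith, not_le.1 ht⟩
    exact measure_mono_null this (measure_iUnion_null hn)
  intro n
  set s := Ico (-n : ℝ) 0
  have hs : MeasurableSet s := measurableSet_Ico
  have hi : Measurable (s.indicator (1 : ℝ → ℝ)) := measurable_one.indicator hs
  set w := E.calculus.int u (s.indicator 1)
  have hw : MemLp (fun t => t) 2 (E.calculus.measure w) := by
    rw [memLp_int_iff measurable_id' hi (memLp_indicator hs u)]
    refine memLp_of_bounded (C := n) (measurable_id'.mul hi) (fun x => ?_) _ _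
    by_cases hx : x ∈ s
    · simpa [hx] using abs_le.2 ⟨hx.1, hx.2.le.trans n.cast_nonneg⟩
    · simp [hx]
  have h0 := hB ⟨w, (h.mem_domain_iff w).2 hw⟩
  rw [h.inner_eq, ← calculus_measure, measure_int hi (memLp_indicator hs u)] at h0
  have e : (E.calculus.measure u).withDensity (fun x => ENNReal.ofReal (s.indicator 1 x ^ 2)) =
      (E.measure u).restrict s := by
    rw [← withDensity_indicator_one hs]
    congr 1
    ext x
    by_cases hx : x ∈ s <;> simp [hx]
  rw [e] at h0
  have h1 : ∫ t in s, -t ∂(E.measure u) = 0 := by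
    refine le_antisymm (by rw [integral_neg]; linarith) (setIntegral_nonneg hs fun x hx => ?_)
    linarith [hx.2]
  rw [setIntegral_eq_zero_iff_of_nonneg_ae] at h1
  · rw [Filter.EventuallyEq, ae_restrict_iff' hs] at h1
    refine measure_mono_null (fun x hx => ?_) h1
    simpa [hx] using hx.2.ne
  · exact (ae_restrict_iff' hs).2 (ae_of_all _ fun x hx => by simpa using hx.2.le)
  · refine (integrableOn_const (C := (n : ℝ)) (by simp)).mono'
      measurable_neg.aestronglyMeasurable ?_
    refine (ae_restrict_iff' hs).2 (ae_of_all _ fun x hx => ?_)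
    rw [norm_neg, Real.norm_eq_abs]
    exact abs_le.2 ⟨hx.1, hx.2.le.trans n.cast_nonneg⟩

end SpectralFamily

/-! ### Polynomials in a symmetric contraction -/

section Polynomials

open Polynomial

variable {H : Type*} [NormedAddCommGroup H] [InnerProductSpace ℝ H]

/-- `T` is symmetric and `0 ≤ T ≤ 1` in the sense of quadratic forms. -/
structure IsPositiveContraction (T : H →L[ℝ] H) : Prop where
  symm : ∀ u v, ⟪T u, v⟫ = ⟪u, T v⟫
  nonneg : ∀ u, 0 ≤ ⟪T u, u⟫
  le_one : ∀ u, ⟪T u, u⟫ ≤ ‖u‖ ^ 2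

theorem inner_aeval_symm {T : H →L[ℝ] H} (hT : ∀ u v, ⟪T u, v⟫ = ⟪u, T v⟫) (p : ℝ[X]) (u v : H) :
    ⟪aeval T p u, v⟫ = ⟪u, aeval T p v⟫ := by
  induction p using Polynomial.induction_on' with
  | add p q hp hq => simp only [map_add, add_apply, inner_add_left, inner_add_right, hp, hq]
  | monomial n a =>
    rw [aeval_monomial, ← Algebra.smul_def, smul_apply, smul_apply, real_inner_smul_left,
      real_inner_smul_right]
    congr 1
    induction n generalizing v with
    | zero => rfl
    | succ n ih =>
      rw [pow_succ', mul_apply_eq_comp, hT, ih, ← mul_apply_eq_comp, ← pow_succ, pow_succ']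

/-- An affine function of `T` is bounded below by the smaller of its values at `0` and `1`. -/
theorem IsPositiveContraction.le_affine {T : H →L[ℝ] H} (hT : IsPositiveContraction T) (b c : ℝ)
    (u : H) : min c (b + c) * ‖u‖ ^ 2 ≤ b * ⟪T u, u⟫ + c * ‖u‖ ^ 2 := by
  have e : b * ⟪T u, u⟫ + c * ‖u‖ ^ 2 = c * (‖u‖ ^ 2 - ⟪T u, u⟫) + (b + c) * ⟪T u, u⟫ := by ring
  rw [e]
  have h2 := mul_le_mul_of_nonneg_right (min_le_left c (b + c)) (sub_nonneg.2 (hT.le_one u))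
  have h3 := mul_le_mul_of_nonneg_right (min_le_right c (b + c)) (hT.nonneg u)
  linarith

/-- A positive invertible operator is coercive. -/
theorem exists_le_inner_of_isUnit {S : H →L[ℝ] H} (hS : ∀ u v, ⟪S u, v⟫ = ⟪u, S v⟫)
    (h0 : ∀ u, 0 ≤ ⟪S u, u⟫) (hu : IsUnit S) : ∃ δ > 0, ∀ u, δ * ‖u‖ ^ 2 ≤ ⟪S u, u⟫ := by
  obtain ⟨R, hR⟩ := hu.exists_left_inv
  have hK : 0 < ‖S‖ + 1 := by positivity
  have hC : 0 < ‖R‖ + 1 := by positivity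
  refine ⟨1 / ((‖S‖ + 1) * (‖R‖ + 1) ^ 2), by positivity, fun u => ?_⟩
  have h1 : ‖u‖ ≤ (‖R‖ + 1) * ‖S u‖ := by
    calc ‖u‖ = ‖R (S u)‖ := by rw [← mul_apply_eq_comp, hR, one_apply_eq_self]
      _ ≤ ‖R‖ * ‖S u‖ := R.le_opNorm _
      _ ≤ _ := by gcongr; linarith
  have h2 : ⟪S (S u), S u⟫ ≤ (‖S‖ + 1) * ‖S u‖ ^ 2 := by
    calc ⟪S (S u), S u⟫ ≤ ‖S (S u)‖ * ‖S u‖ := real_inner_le_norm _ _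
      _ ≤ (‖S‖ * ‖S u‖) * ‖S u‖ := by gcongr; exact S.le_opNorm _
      _ ≤ _ := by nlinarith [sq_nonneg ‖S u‖]
  -- positivity at `u - t S u` with the optimal choice `t = 1 / (‖S‖ + 1)`
  have h3 := h0 (u - (1 / (‖S‖ + 1)) • S u)
  rw [map_sub, map_smul, inner_sub_left, inner_sub_right, inner_sub_right, real_inner_smul_left,
    real_inner_smul_right, real_inner_smul_left, real_inner_smul_right, hS (S u) u,
    real_inner_self_eq_norm_sq] at h3
  have h4 : ‖S u‖ ^ 2 / (‖S‖ + 1) ≤ ⟪S u, u⟫ := by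
    have : 1 / (‖S‖ + 1) * (1 / (‖S‖ + 1) * ⟪S (S u), S u⟫) ≤ ‖S u‖ ^ 2 / (‖S‖ + 1) := by
      calc _ ≤ 1 / (‖S‖ + 1) * (1 / (‖S‖ + 1) * ((‖S‖ + 1) * ‖S u‖ ^ 2)) := by gcongr
        _ = _ := by field_simp
    have e : 1 / (‖S‖ + 1) * ‖S u‖ ^ 2 = ‖S u‖ ^ 2 / (‖S‖ + 1) := by ring
    rw [e] at h3
    linarith
  refine le_trans ?_ h4
  rw [div_mul_eq_mul_div, one_mul, div_le_div_iff₀ (by positivity) hK]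
  have h5 := pow_le_pow_left₀ (norm_nonneg _) h1 2
  rw [mul_pow] at h5
  nlinarith

variable [CompleteSpace H]

theorem isUnit_of_le_inner {S : H →L[ℝ] H} {δ : ℝ} (hδ : 0 < δ)
    (h : ∀ u, δ * ‖u‖ ^ 2 ≤ |⟪S u, u⟫|) : IsUnit S := by
  refine S.isUnit_of_forall_le_norm_inner_map (c := ⟨δ, hδ.le⟩) hδ fun u => ?_
  rw [mul_comm, Real.norm_eq_abs]
  exact h u

/-- The operator `p(T)` is invertible if `p` has no zero on `[0, 1]`. Irreducible polynomials are
affine, of constant sign on `[0, 1]`, or quadratic with negative discriminant, hence definite; in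
both cases the quadratic form of `p(T)` is coercive up to sign. -/
theorem IsPositiveContraction.isUnit_aeval {T : H →L[ℝ] H} (hT : IsPositiveContraction T)
    (p : ℝ[X]) (hp : ∀ x ∈ Icc (0 : ℝ) 1, p.eval x ≠ 0) : IsUnit (aeval T p) := by
  induction p using UniqueFactorizationMonoid.induction_on_prime with
  | h₁ => exact absurd eval_zero (hp 0 (by simp))
  | h₂ p h => exact h.map (aeval T)
  | h₃ p q _ hq ih =>
    rw [map_mul]
    refine IsUnit.mul ?_ (ih fun x hx h => hp x hx (by rw [eval_mul, h, mul_zero]))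
    replace hp : ∀ x ∈ Icc (0 : ℝ) 1, q.eval x ≠ 0 := fun x hx h =>
      hp x hx (by rw [eval_mul, h, zero_mul])
    have hirr := hq.irreducible
    have hq2 := eq_quadratic_of_degree_le_two hirr.degree_le_two
    set a := q.coeff 2
    set b := q.coeff 1
    set c := q.coeff 0
    have hev : ∀ x, q.eval x = a * x ^ 2 + b * x + c := fun x => by rw [hq2]; simp
    have hform : ∀ u, ⟪aeval T q u, u⟫ = a * ‖T u‖ ^ 2 + b * ⟪T u, u⟫ + c * ‖u‖ ^ 2 := fun u => by
      have e : aeval T q = a • (T * T) + b • T + c • (1 : H →L[ℝ] H) := by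
        rw [hq2]
        simp [Algebra.algebraMap_eq_smul_one, pow_two]
      rw [e]
      simp only [add_apply, smul_apply, mul_apply_eq_comp, one_apply_eq_self, inner_add_left,
        real_inner_smul_left, real_inner_self_eq_norm_sq]
      rw [hT.symm (T u) u, real_inner_self_eq_norm_sq]
    by_cases ha : a = 0
    · simp only [ha, zero_mul, zero_add] at hev hform
      have hc : c ≠ 0 := by simpa [hev] using hp 0 (by simp)
      have hbc : b + c ≠ 0 := by simpa [hev] using hp 1 (by simp)
      -- otherwise the zero `-c / b` of `b x + c` lies between the end points `0` and `1`
      have hsign : 0 < c * (b + c) := by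
        by_contra hneg
        have hb : b ≠ 0 := fun hb => hneg (by rw [hb, zero_add]; exact mul_self_pos.2 hc)
        refine hp (-c / b) ?_ (by rw [hev]; field_simp; ring)
        have h2 : 0 < b ^ 2 := by positivity
        have e : -c / b = -(c * b) / b ^ 2 := by field_simp
        rw [e]
        constructor
        · exact div_nonneg (by nlinarith [sq_nonneg c]) h2.le
        · rw [div_le_one h2]
          nlinarith [sq_nonneg (b + c)]
      rcases lt_or_gt_of_ne hc with h0 | h0
      · have h1 : b + c < 0 := by nlinarith
        refine isUnit_of_le_inner (δ := min (-c) (-b + -c)) (by simp; grind) fun u => ?_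
        rw [hform]
        refine (hT.le_affine (-b) (-c) u).trans (le_trans (le_of_eq ?_) (neg_le_abs _))
        ring
      · have h1 : 0 < b + c := by nlinarith
        refine isUnit_of_le_inner (δ := min c (b + c)) (by simp [h0, h1]) fun u => ?_
        rw [hform]
        exact (hT.le_affine b c u).trans (le_abs_self _)
    · have hdisc : b ^ 2 - 4 * a * c < 0 := by
        by_contra hneg
        obtain ⟨x, hx⟩ := exists_quadratic_eq_zero ha
          ⟨√(discrim a b c), (Real.mul_self_sqrt (not_lt.1 hneg)).symm⟩
        have hd := degree_eq_one_of_irreducible_of_root hirr (x := x) (by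
          rw [IsRoot, hev]; linarith)
        exact ha (coeff_eq_zero_of_degree_lt (by rw [hd]; norm_num))
      refine isUnit_of_le_inner (δ := (4 * a * c - b ^ 2) / (4 * |a|))
        (div_pos (by linarith) (by positivity)) fun u => ?_
      rw [div_mul_eq_mul_div, div_le_iff₀ (by positivity), hform]
      have h4 : ‖(2 * a) • T u + b • u‖ ^ 2 + (4 * a * c - b ^ 2) * ‖u‖ ^ 2 =
          4 * (a * (a * ‖T u‖ ^ 2 + b * ⟪T u, u⟫ + c * ‖u‖ ^ 2)) := by
        rw [norm_add_sq_real, real_inner_smul_left, real_inner_smul_right, norm_smul, norm_smul,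
          mul_pow, mul_pow, Real.norm_eq_abs, Real.norm_eq_abs, sq_abs, sq_abs]
        ring
      have h5 := le_abs_self (a * (a * ‖T u‖ ^ 2 + b * ⟪T u, u⟫ + c * ‖u‖ ^ 2))
      rw [abs_mul] at h5
      nlinarith [sq_nonneg ‖(2 * a) • T u + b • u‖]

/-- The polynomial calculus is positive: at the smallest `c` for which `p(T) + c ≥ 0`, the operator
`p(T) + c` is not coercive, hence not invertible, so `p + c` has a zero on `[0, 1]`. -/
theorem IsPositiveContraction.inner_aeval_nonneg {T : H →L[ℝ] H} (hT : IsPositiveContraction T)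
    (p : ℝ[X]) (hp : ∀ x ∈ Icc (0 : ℝ) 1, 0 ≤ p.eval x) (u : H) : 0 ≤ ⟪aeval T p u, u⟫ := by
  set S := aeval T p
  set 𝒞 : Set ℝ := {c | ∀ u, 0 ≤ ⟪S u, u⟫ + c * ‖u‖ ^ 2} with h𝒞
  suffices h : (0 : ℝ) ∈ 𝒞 by simpa using h u
  by_contra h0
  have hup : ∀ c ∈ 𝒞, ∀ d, c ≤ d → d ∈ 𝒞 := fun c hc d hcd v => by
    have := hc v
    have := mul_le_mul_of_nonneg_right hcd (sq_nonneg ‖v‖)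
    linarith
  have hpos : ∀ c ∈ 𝒞, 0 < c := fun c hc => not_le.1 fun hc0 => h0 (hup c hc 0 hc0)
  have hbdd : BddBelow 𝒞 := ⟨0, fun c hc => (hpos c hc).le⟩
  have hne : 𝒞.Nonempty := ⟨‖S‖, fun v => by
    have h1 := neg_le_of_abs_le (abs_real_inner_le_norm (S v) v)
    have h2 := mul_le_mul_of_nonneg_right (S.le_opNorm v) (norm_nonneg v)
    nlinarith⟩
  have hclosed : IsClosed 𝒞 := by
    simp only [h𝒞, ofPred_forall]
    exact isClosed_iInter fun v => isClosed_le continuous_const (by fun_prop)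
  have hmem := hclosed.csInf_mem hne hbdd
  set c := sInf 𝒞
  have hS' : ∀ v, aeval T (p + C c) v = S v + c • v := fun v => by
    simp [S, Algebra.algebraMap_eq_smul_one]
  have hform : ∀ v, ⟪aeval T (p + C c) v, v⟫ = ⟪S v, v⟫ + c * ‖v‖ ^ 2 := fun v => by
    rw [hS', inner_add_left, real_inner_smul_left, real_inner_self_eq_norm_sq]
  obtain ⟨δ, hδ, h⟩ := exists_le_inner_of_isUnit (inner_aeval_symm hT.symm (p + C c))
    (fun v => by rw [hform]; exact hmem v) (hT.isUnit_aeval _ fun x hx => by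
      rw [eval_add, eval_C]
      exact (add_pos_of_nonneg_of_pos (hp x hx) (hpos c hmem)).ne')
  have : c - δ ∈ 𝒞 := fun v => by
    have := h v
    rw [hform] at this
    linarith
  linarith [csInf_le hbdd this]

end Polynomials

/-! ### The functional calculus of a symmetric contraction -/

section Contraction

open Polynomial

variable {H : Type*} [NormedAddCommGroup H] [InnerProductSpace ℝ H]

/-- Restriction of polynomials to `[0, 1]`. -/
def polyToC : ℝ[X] →ₗ[ℝ] C(Icc (0 : ℝ) 1, ℝ) :=
  (toContinuousMapOnAlgHom (Icc (0 : ℝ) 1)).toLinearMap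

theorem polyToC_apply (p : ℝ[X]) (x : Icc (0 : ℝ) 1) : polyToC p x = p.eval (x : ℝ) := rfl

theorem denseRange_polyToC : DenseRange polyToC := by
  have h := polynomialFunctions_closure_eq_top 0 1
  rw [polynomialFunctions, Algebra.map_top] at h
  have h' := congrArg (fun s : Subalgebra ℝ C(Icc (0 : ℝ) 1, ℝ) => (s : Set C(Icc (0 : ℝ) 1, ℝ))) h
  exact dense_iff_closure_eq.2 h'

variable [CompleteSpace H]

/-- The spectral measures of `T`, from the Riesz–Markov–Kakutani theorem. -/
theorem IsPositiveContraction.exists_measure {T : H →L[ℝ] H} (hT : IsPositiveContraction T)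
    (u : H) : ∃ m : Measure (Icc (0 : ℝ) 1), IsFiniteMeasure m ∧
      ∀ p : ℝ[X], ⟪aeval T p u, u⟫ = ∫ x, p.eval (x : ℝ) ∂m := by
  set f : ℝ[X] →ₗ[ℝ] ℝ :=
    (innerₛₗ ℝ u) ∘ₗ (ContinuousLinearMap.apply ℝ H u).toLinearMap ∘ₗ (aeval T).toLinearMap
  have hfp : ∀ p, f p = ⟪aeval T p u, u⟫ := fun p => real_inner_comm _ _
  have hf0 : ∀ p : ℝ[X], (∀ x ∈ Icc (0 : ℝ) 1, 0 ≤ p.eval x) → 0 ≤ f p := fun p hp =>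
    (hT.inner_aeval_nonneg p hp u).trans_eq (hfp p).symm
  have hfC : ∀ c, f (C c) = c * ‖u‖ ^ 2 := fun c => by
    rw [hfp, aeval_C, Algebra.algebraMap_eq_smul_one, smul_apply, one_apply_eq_self,
      real_inner_smul_left, real_inner_self_eq_norm_sq]
  have hbound : ∀ p, ‖f p‖ ≤ ‖u‖ ^ 2 * ‖polyToC p‖ := fun p => by
    have hx : ∀ x ∈ Icc (0 : ℝ) 1, |p.eval x| ≤ ‖polyToC p‖ := fun x hx =>
      (polyToC p).norm_coe_le_norm ⟨x, hx⟩
    have h1 := hf0 (C ‖polyToC p‖ - p) fun x h => by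
      rw [eval_sub, eval_C]; linarith [(abs_le.1 (hx x h)).2]
    have h2 := hf0 (C ‖polyToC p‖ + p) fun x h => by
      rw [eval_add, eval_C]; linarith [(abs_le.1 (hx x h)).1]
    rw [map_sub, hfC] at h1
    rw [map_add, hfC] at h2
    rw [Real.norm_eq_abs, abs_le]
    constructor <;> linarith
  set Λ := f.extendOfNorm polyToC
  have hΛ : ∀ p, Λ (polyToC p) = f p := LinearMap.extendOfNorm_eq denseRange_polyToC ⟨_, hbound⟩
  have hΛ0 : ∀ g : C(Icc (0 : ℝ) 1, ℝ), 0 ≤ g → 0 ≤ Λ g := fun g hg => by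
    obtain ⟨a, ha, hlim⟩ := mem_closure_iff_seq_limit.1 (denseRange_polyToC g)
    choose p hp using ha
    -- correct the approximations of `g` by the error, so that they become nonnegative
    have h1 : ∀ n, 0 ≤ f (p n + C ‖a n - g‖) := fun n => hf0 _ fun x hx => by
      have h2 := (abs_le.1 ((a n - g).norm_coe_le_norm ⟨x, hx⟩)).1
      have h3 : (0 : ℝ) ≤ g ⟨x, hx⟩ := hg ⟨x, hx⟩
      rw [ContinuousMap.sub_apply, ← hp n, polyToC_apply] at h2
      rw [eval_add, eval_C, ← hp n]
      linarith
    simp only [map_add, hfC] at h1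
    simp only [← hΛ, hp] at h1
    have h4 : Tendsto (fun n => Λ (a n) + ‖a n - g‖ * ‖u‖ ^ 2) atTop (𝓝 (Λ g + 0 * ‖u‖ ^ 2)) :=
      ((Λ.continuous.tendsto g).comp hlim).add
        ((tendsto_iff_norm_sub_tendsto_zero.1 hlim).mul_const _)
    simpa using ge_of_tendsto' h4 h1
  let Λ' : CompactlySupportedContinuousMap (Icc (0 : ℝ) 1) ℝ →ₚ[ℝ] ℝ :=
    PositiveLinearMap.mk₀
      { toFun := fun g => Λ g.toContinuousMap
        map_add' := fun g h => Λ.map_add g.toContinuousMap h.toContinuousMap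
        map_smul' := fun c g => Λ.map_smul c g.toContinuousMap }
      fun g hg => hΛ0 _ hg
  refine ⟨RealRMK.rieszMeasure Λ', inferInstance, fun p => ?_⟩
  rw [← hfp, ← hΛ]
  exact (RealRMK.integral_rieszMeasure Λ'
    (CompactlySupportedContinuousMap.continuousMapEquiv (polyToC p))).symm

/-- The calculus `p ↦ p(T)` on polynomials, considered as functions on `[0, 1]`. -/
def IsPositiveContraction.calculus {T : H →L[ℝ] H} (hT : IsPositiveContraction T) :
    FunctionalCalculus (Icc (0 : ℝ) 1) ℝ[X] H where
  fn := ContinuousMap.coeFnLinearMap ℝ ∘ₗ polyToC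
  op := (aeval T).toLinearMap
  measure u := (hT.exists_measure u).choose
  isFiniteMeasure u := (hT.exists_measure u).choose_spec.1
  measurable_fn p := (polyToC p).continuous.measurable
  bounded_fn p := ⟨‖polyToC p‖, (polyToC p).norm_coe_le_norm⟩
  op_symm := inner_aeval_symm hT.symm
  exists_mul p q := ⟨p * q, by ext x; simp [polyToC_apply], by simp⟩
  inner_op_self p u := (hT.exists_measure u).choose_spec.2 p
  measureReal_univ u := by
    have := (hT.exists_measure u).choose_spec.2 1
    simp only [map_one, one_apply_eq_self, real_inner_self_eq_norm_sq, eval_one, integral_const,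
      smul_eq_mul, mul_one] at this
    exact this.symm
  ext_measure m₁ m₂ h₁ h₂ h := by
    refine ext_of_forall_integral_eq_of_IsFiniteMeasure fun g => ?_
    have hc : ∀ (m : Measure (Icc (0 : ℝ) 1)) [IsFiniteMeasure m],
        Continuous fun g : C(Icc (0 : ℝ) 1, ℝ) => ∫ x, g x ∂m := fun m _ => by
      have := continuous_integral.comp (ContinuousMap.toLp (E := ℝ) 1 m ℝ).continuous
      refine this.congr fun g => integral_congr_ae ?_
      exact ContinuousMap.coeFn_toLp m g
    exact denseRange_polyToC.induction_on (p := fun g : C(Icc (0 : ℝ) 1, ℝ) =>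
      ∫ x, g x ∂m₁ = ∫ x, g x ∂m₂) g.toContinuousMap (isClosed_eq (hc m₁) (hc m₂)) h

theorem IsPositiveContraction.calculus_X {T : H →L[ℝ] H} (hT : IsPositiveContraction T) (u : H) :
    hT.calculus.int u (fun x : Icc (0 : ℝ) 1 => (x : ℝ)) = T u := by
  have h := FunctionalCalculus.int_fn (Φ := hT.calculus) u X
  have h1 : hT.calculus.fn X = fun x : Icc (0 : ℝ) 1 => (x : ℝ) := by
    ext x
    exact (polyToC_apply X x).trans eval_X
  rw [h1] at h
  rw [h]
  exact congrArg (fun S : H →L[ℝ] H => S u) (aeval_X T)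

end Contraction

/-! ### The spectral theorem for positive self-adjoint operators -/

section SpectralTheorem

variable {H : Type*} [NormedAddCommGroup H] [InnerProductSpace ℝ H] {A : H →ₗ.[ℝ] H}

/-- The operator `1 + A` on the domain of `A`. -/
def oneAdd (A : H →ₗ.[ℝ] H) : A.domain →ₗ[ℝ] H := A.domain.subtype + A.toFun

theorem oneAdd_apply (u : A.domain) : oneAdd A u = u + A u := rfl

variable [CompleteSpace H]

theorem IsPositiveSelfAdjoint.symm (hA : IsPositiveSelfAdjoint A) (u v : A.domain) :
    ⟪A u, (v : H)⟫ = ⟪(u : H), A v⟫ := by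
  have h := LinearPMap.adjoint_isFormalAdjoint hA.isSelfAdjoint.dense_domain
  rw [LinearPMap.isSelfAdjoint_def.1 hA.isSelfAdjoint] at h
  exact h u v

theorem IsPositiveSelfAdjoint.norm_le_oneAdd (hA : IsPositiveSelfAdjoint A) (u : A.domain) :
    ‖(u : H)‖ ≤ ‖oneAdd A u‖ := by
  have h1 := real_inner_le_norm (oneAdd A u) u
  rw [oneAdd_apply, inner_add_left, real_inner_self_eq_norm_sq, ← oneAdd_apply] at h1
  have h2 := hA.nonneg u
  by_contra! h3
  nlinarith [norm_nonneg (u : H), norm_nonneg (oneAdd A u)]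

theorem IsPositiveSelfAdjoint.isClosed_range_oneAdd (hA : IsPositiveSelfAdjoint A) :
    IsClosed ((oneAdd A).range : Set H) := by
  have hG : IsClosed (A.graph : Set (H × H)) := hA.isSelfAdjoint.isClosed
  have : CompleteSpace A.graph := hG.completeSpace_coe
  -- the sum of the components, as a bounded operator on the complete space `A.graph`
  let S : A.graph →L[ℝ] H :=
    (ContinuousLinearMap.fst ℝ H H + ContinuousLinearMap.snd ℝ H H).comp A.graph.subtypeL
  have hS : ∀ u : A.domain, ∀ h, S ⟨(u, A u), h⟩ = oneAdd A u := fun u h => rfl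
  have hanti : AntilipschitzWith 2 S := by
    refine AddMonoidHomClass.antilipschitz_of_bound S ?_
    rintro ⟨⟨x, y⟩, hxy⟩
    obtain ⟨u, rfl, rfl⟩ := (LinearPMap.mem_graph_iff _).1 hxy
    rw [hS]
    have h1 := hA.norm_le_oneAdd u
    have h2 : ‖A u‖ ≤ ‖oneAdd A u‖ + ‖(u : H)‖ := by
      rw [show A u = oneAdd A u - u by rw [oneAdd_apply]; abel]
      exact norm_sub_le _ _
    have h3 := norm_nonneg (oneAdd A u)
    refine max_le ?_ ?_ <;> push_cast
    · change ‖(u : H)‖ ≤ _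
      linarith
    · change ‖A u‖ ≤ _
      linarith
  convert! hanti.isClosed_range S.uniformContinuous
  ext v
  constructor
  · rintro ⟨u, rfl⟩
    exact ⟨⟨(u, A u), A.mem_graph u⟩, rfl⟩
  · rintro ⟨⟨⟨x, y⟩, hxy⟩, rfl⟩
    obtain ⟨u, rfl, rfl⟩ := (LinearPMap.mem_graph_iff _).1 hxy
    exact ⟨u, rfl⟩

/-- The range of `1 + A` is closed, and a vector `v` orthogonal to it satisfies `A† v = -v`, which
is impossible for `v ≠ 0` as `A† = A` is positive. -/
theorem IsPositiveSelfAdjoint.bijective_oneAdd (hA : IsPositiveSelfAdjoint A) :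
    Function.Bijective (oneAdd A) := by
  constructor
  · rw [← LinearMap.ker_eq_bot, LinearMap.ker_eq_bot']
    intro u hu
    have := hA.norm_le_oneAdd u
    rw [hu, norm_zero] at this
    exact Subtype.ext (norm_le_zero_iff.1 this)
  · rw [← LinearMap.range_eq_top, ← hA.isClosed_range_oneAdd.submodule_topologicalClosure_eq,
      Submodule.topologicalClosure_eq_top_iff, Submodule.eq_bot_iff]
    intro v hv
    have hdense := hA.isSelfAdjoint.dense_domain
    have h1 : ∀ x : A.domain, ⟪-v, (x : H)⟫ = ⟪v, A x⟫ := fun x => by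
      have := (Submodule.mem_orthogonal' _ _).1 hv _ (LinearMap.mem_range_self _ x)
      rw [oneAdd_apply, inner_add_right] at this
      rw [inner_neg_left]
      linarith
    have h2 : v ∈ A.adjoint.domain := LinearPMap.mem_adjoint_domain_of_exists v ⟨-v, h1⟩
    have h3 := LinearPMap.adjoint_apply_eq hdense ⟨v, h2⟩ h1
    have h4 : ∃ h : v ∈ A.domain, A ⟨v, h⟩ = -v := by
      have e := LinearPMap.isSelfAdjoint_def.1 hA.isSelfAdjoint
      have hg : (v, -v) ∈ A.adjoint.graph := (LinearPMap.mem_graph_iff _).2 ⟨⟨v, h2⟩, rfl, h3⟩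
      rw [e] at hg
      obtain ⟨u, hu, hu'⟩ := (LinearPMap.mem_graph_iff _).1 hg
      simp only at hu hu'
      subst hu
      exact ⟨u.2, hu'⟩
    obtain ⟨h, h5⟩ := h4
    have h6 := hA.nonneg ⟨v, h⟩
    rw [h5, inner_neg_left, real_inner_self_eq_norm_sq] at h6
    exact norm_eq_zero.1 (pow_eq_zero_iff two_ne_zero |>.1 (by nlinarith [sq_nonneg ‖v‖]))

/-- The operator `(1 + A)⁻¹`. -/
theorem IsPositiveSelfAdjoint.exists_resolvent (hA : IsPositiveSelfAdjoint A) :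
    ∃ T : H →L[ℝ] H, IsPositiveContraction T ∧ (∀ u : A.domain, T (u + A u) = u) ∧
      ∀ v, ∃ u : A.domain, u + A u = v := by
  let e := LinearEquiv.ofBijective (oneAdd A) hA.bijective_oneAdd
  have he : ∀ u : A.domain, e.symm (u + A u) = u := fun u => e.symm_apply_apply u
  let T : H →L[ℝ] H := (A.domain.subtype ∘ₗ e.symm.toLinearMap).mkContinuous 1 fun v => by
    obtain ⟨u, rfl⟩ := e.surjective v
    rw [one_mul]
    rw [LinearMap.comp_apply, LinearEquiv.coe_coe, e.symm_apply_apply]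
    exact hA.norm_le_oneAdd u
  have hT : ∀ u : A.domain, T (u + A u) = u := fun u => congrArg Subtype.val (he u)
  have hsurj : ∀ v, ∃ u : A.domain, u + A u = v := hA.bijective_oneAdd.2
  refine ⟨T, ⟨fun v w => ?_, fun v => ?_, fun v => ?_⟩, hT, hsurj⟩
  · obtain ⟨u, rfl⟩ := hsurj v
    obtain ⟨x, rfl⟩ := hsurj w
    rw [hT, hT, inner_add_left, inner_add_right, hA.symm]
  · obtain ⟨u, rfl⟩ := hsurj v
    rw [hT, inner_add_right, ← hA.symm]
    exact add_nonneg real_inner_self_nonneg (hA.nonneg u)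
  · obtain ⟨u, rfl⟩ := hsurj v
    rw [hT, inner_add_right, real_inner_self_eq_norm_sq, norm_add_sq_real]
    have h1 := hA.nonneg u
    rw [real_inner_comm] at h1
    nlinarith [sq_nonneg ‖A u‖]

/-- The spectral theorem. The spectral family of `A` is that of the function `x⁻¹ - 1` of the
resolvent `T = (1 + A)⁻¹`; as `T` is injective, its spectral measures have no atom at `0`. -/
theorem IsPositiveSelfAdjoint.exists_spectralFamily (hA : IsPositiveSelfAdjoint A) :
    ∃ E : SpectralFamily H, E.IsIntegral (fun t => t) A := by
  obtain ⟨T, hT, hTA, hsurj⟩ := hA.exists_resolvent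
  set Φ := hT.calculus
  set ι : Icc (0 : ℝ) 1 → ℝ := fun x => (x : ℝ)
  have hιm : Measurable ι := measurable_subtype_coe
  have hιL : ∀ u, MemLp ι 2 (Φ.measure u) := fun u =>
    memLp_of_bounded (C := 1) hιm (fun x => abs_le.2 ⟨by linarith [x.2.1], x.2.2⟩) _ _
  have hιT : ∀ u, Φ.int u ι = T u := hT.calculus_X
  set θ : Icc (0 : ℝ) 1 → ℝ := ι⁻¹ - 1 with hθ
  have hθm : Measurable θ := hιm.inv.sub measurable_one
  have hTinj : ∀ v, T v = 0 → v = 0 := fun v hv => by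
    obtain ⟨u, rfl⟩ := hsurj v
    rw [hTA] at hv
    have : u = 0 := Subtype.ext hv
    rw [this, A.map_zero, Submodule.coe_zero, add_zero]
  have hatom : ∀ u, ∀ᵐ x ∂(Φ.measure u), ι x ≠ 0 := fun u => by
    have hs : MeasurableSet {x | ι x = 0} := measurableSet_eq_fun hιm measurable_const
    have e : ι * {x | ι x = 0}.indicator (1 : Icc (0 : ℝ) 1 → ℝ) = 0 := by
      ext x
      by_cases hx : ι x = 0 <;> simp [hx]
    have h1 : Φ.int u ({x | ι x = 0}.indicator 1) = 0 := by
      refine hTinj _ ?_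
      rw [← hιT, FunctionalCalculus.int_int hιm (measurable_one.indicator hs)
        (FunctionalCalculus.memLp_indicator hs u) (by rw [e]; exact MemLp.zero), e, ← norm_eq_zero,
        ← sq_eq_zero_iff, FunctionalCalculus.norm_int_sq MemLp.zero]
      simp
    have h2 := FunctionalCalculus.norm_int_indicator_sq (Φ := Φ) hs u
    rw [h1, norm_zero, zero_pow two_ne_zero, eq_comm, measureReal_eq_zero_iff] at h2
    simpa [ae_iff] using h2
  have hinv : ∀ u, ι * ι⁻¹ =ᵐ[Φ.measure u] 1 := fun u => (hatom u).mono fun x hx => by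
    simp [hx]
  have hθL : ∀ u, MemLp θ 2 (Φ.measure u) ↔ MemLp ι⁻¹ 2 (Φ.measure u) := fun u =>
    ⟨fun h => by simpa [hθ] using h.add (Φ.memLp_one u), fun h => h.sub (Φ.memLp_one u)⟩
  -- the domain of `A` is the range of `T`
  have hdom : ∀ u, u ∈ A.domain ↔ MemLp ι⁻¹ 2 (Φ.measure u) := fun u => by
    constructor
    · intro hu
      rw [← show T (u + A ⟨u, hu⟩) = u from hTA ⟨u, hu⟩, ← hιT,
        FunctionalCalculus.memLp_int_iff hιm.inv hιm (hιL _), mul_comm, memLp_congr_ae (hinv _)]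
      exact Φ.memLp_one _
    · intro hu
      have h1 : T (Φ.int u ι⁻¹) = u := by
        rw [← hιT, FunctionalCalculus.int_int hιm hιm.inv hu
          ((memLp_congr_ae (hinv u)).2 (Φ.memLp_one u)), FunctionalCalculus.int_congr (hinv u),
          FunctionalCalculus.int_one]
      obtain ⟨w, hw⟩ := hsurj (Φ.int u ι⁻¹)
      rw [← hw, hTA] at h1
      exact h1 ▸ w.2
  refine ⟨Φ.spectralFamily θ hθm, hA.symm, fun u => ?_, fun u => ?_⟩
  · rw [Φ.spectralFamily_measure hθm, memLp_map_measure_iff (by fun_prop) hθm.aemeasurable, hdom,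
      ← hθL]
    rfl
  · rw [Φ.spectralFamily_measure hθm, integral_map hθm.aemeasurable (by fun_prop)]
    have hu := (hdom u).1 u.2
    have h1 : Φ.int (u : H) ι⁻¹ = u + A u := by
      rw [← sub_eq_zero]
      refine hTinj _ ?_
      rw [map_sub, hTA, ← hιT, FunctionalCalculus.int_int hιm hιm.inv hu
          ((memLp_congr_ae (hinv u)).2 (Φ.memLp_one u)), FunctionalCalculus.int_congr (hinv u),
          FunctionalCalculus.int_one, sub_self]
    have h2 : Φ.int (u : H) θ = A u := by
      rw [hθ, FunctionalCalculus.int_sub_fun hu (Φ.memLp_one _), h1, FunctionalCalculus.int_one]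
      abel
    rw [← h2, FunctionalCalculus.inner_int_self ((hθL u).2 hu)]

end SpectralTheorem

/-! ### Comparison of moments and Gevrey vectors of fractional powers -/

theorem rpow_le_one_add_rpow {x a b : ℝ} (hx : 0 ≤ x) (ha : 0 ≤ a) (hab : a ≤ b) :
    x ^ a ≤ 1 + x ^ b := by
  rcases le_total x 1 with h | h
  · exact (Real.rpow_le_one hx h ha).trans (le_add_of_nonneg_right (Real.rpow_nonneg hx b))
  · exact (Real.rpow_le_rpow_of_exponent_le h hab).trans (le_add_of_nonneg_left zero_le_one)

/-- Gevrey growth of the `L²` norms of `t ^ (p n)` implies that of `t ^ (q n)`. With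
`m = ⌈q n / p⌉` and `l = R ^ (1 / p) * m ^ s`, the bound on the `m`-th norm reads
`‖(t / l) ^ (p m)‖ ≤ 1`, and `(t / l) ^ (2 q n) ≤ 1 + (t / l) ^ (2 p m)`. -/
theorem gevrey_moments {μ : Measure ℝ} [IsFiniteMeasure μ] (hμ : ∀ᵐ t ∂μ, 0 ≤ t) {p q s : ℝ}
    (hp : 0 < p) (hq : 0 < q) (hs : 0 < s)
    (h : ∃ R : ℝ, 0 < R ∧ ∀ n : ℕ, 1 ≤ n → MemLp ((fun t : ℝ => t ^ p) ^ n) 2 μ ∧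
      ∫ t, ((t ^ p) ^ n) ^ 2 ∂μ ≤ (R ^ n * (n : ℝ) ^ (p * s * n)) ^ 2) :
    ∃ R : ℝ, 0 < R ∧ ∀ n : ℕ, 1 ≤ n → MemLp ((fun t : ℝ => t ^ q) ^ n) 2 μ ∧
      ∫ t, ((t ^ q) ^ n) ^ 2 ∂μ ≤ (R ^ n * (n : ℝ) ^ (q * s * n)) ^ 2 := by
  obtain ⟨R, hR, h⟩ := h
  set V := μ.real univ + 1 with hV
  have hV1 : 1 ≤ V := le_add_of_nonneg_left measureReal_nonneg
  have hc : 0 < q / p + 1 := by positivity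
  refine ⟨R ^ (q / p) * (q / p + 1) ^ (q * s) * V, by positivity, fun n hn => ?_⟩
  have hn0 : (1 : ℝ) ≤ n := by exact_mod_cast hn
  set m := ⌈q / p * n⌉₊
  have hm : 1 ≤ m := Nat.one_le_ceil_iff.2 (by positivity)
  have hm0 : (0 : ℝ) < m := by exact_mod_cast hm
  have hmle : (m : ℝ) ≤ (q / p + 1) * n := by
    have := Nat.ceil_lt_add_one (a := q / p * n) (by positivity)
    linarith
  have hmge : q * n ≤ p * m := by
    have := mul_le_mul_of_nonneg_left (Nat.le_ceil (q / p * n)) hp.le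
    calc q * n = p * (q / p * n) := by field_simp
      _ ≤ _ := this
  obtain ⟨hmem, hint⟩ := h m hm
  set l := R ^ (1 / p) * (m : ℝ) ^ s with hl
  have hl0 : 0 < l := by positivity
  have hK : l ^ (p * m) = R ^ m * (m : ℝ) ^ (p * s * m) := by
    rw [hl, Real.mul_rpow (by positivity) (by positivity), ← Real.rpow_mul hR.le,
      ← Real.rpow_mul hm0.le, ← Real.rpow_natCast R m]
    congr 2
    · field_simp
    · ring
  set K := l ^ (p * m)
  set L := l ^ (q * n)
  have hK0 : 0 < K := by positivity
  have hL0 : 0 < L := by positivity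
  have hL : L ≤ (R ^ (q / p) * (q / p + 1) ^ (q * s)) ^ n * (n : ℝ) ^ (q * s * n) := by
    have e1 : L = (R ^ (q / p)) ^ n * (m : ℝ) ^ (q * s * n) := by
      rw [← Real.rpow_mul_natCast hR.le]
      simp only [L, hl]
      rw [Real.mul_rpow (by positivity) (by positivity), ← Real.rpow_mul hR.le,
        ← Real.rpow_mul hm0.le]
      congr 2 <;> ring
    rw [e1, mul_pow, mul_assoc ((R ^ (q / p)) ^ n), ← Real.rpow_mul_natCast hc.le,
      ← Real.mul_rpow hc.le (by positivity)]
    gcongr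
  have scale : ∀ t : ℝ, 0 ≤ t → (t ^ q) ^ n = L * (t / l) ^ (q * n) ∧
      (t ^ p) ^ m = K * (t / l) ^ (p * m) := fun t ht => by
    rw [← Real.rpow_mul_natCast ht, ← Real.rpow_mul_natCast ht,
      ← Real.mul_rpow hl0.le (by positivity), ← Real.mul_rpow hl0.le (by positivity),
      mul_div_cancel₀ t hl0.ne']
    exact ⟨rfl, rfl⟩
  clear_value K L l V m
  have hg : MemLp (fun t : ℝ => L * (1 + K⁻¹ * (t ^ p) ^ m)) 2 μ :=
    MemLp.const_mul ((memLp_const (1 : ℝ)).add (MemLp.const_mul hmem K⁻¹)) L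
  have mem : MemLp ((fun t : ℝ => t ^ q) ^ n) 2 μ := by
    have hqm : Measurable ((fun t : ℝ => t ^ q) ^ n) := (measurable_id.pow_const q).pow_const n
    refine hg.of_le hqm.aestronglyMeasurable ?_
    filter_upwards [hμ] with t ht
    obtain ⟨h1, h2⟩ := scale t ht
    have h3 : 0 ≤ t / l := div_nonneg ht hl0.le
    have h4 := rpow_le_one_add_rpow h3 (by positivity) hmge
    rw [Pi.pow_apply, h1, h2, inv_mul_cancel_left₀ hK0.ne', Real.norm_of_nonneg (by positivity),
      Real.norm_of_nonneg (by positivity)]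
    exact mul_le_mul_of_nonneg_left h4 hL0.le
  refine ⟨mem, ?_⟩
  have hsq : Integrable (fun t : ℝ => ((t ^ p) ^ m) ^ 2) μ := hmem.integrable_sq
  calc ∫ t, ((t ^ q) ^ n) ^ 2 ∂μ ≤ ∫ t, L ^ 2 * (1 + (K ^ 2)⁻¹ * ((t ^ p) ^ m) ^ 2) ∂μ := by
        refine integral_mono_ae mem.integrable_sq
          (((integrable_const 1).add (hsq.const_mul _)).const_mul _) ?_
        filter_upwards [hμ] with t ht
        obtain ⟨h1, h2⟩ := scale t ht
        have h3 := rpow_le_one_add_rpow (x := (t / l) ^ 2) (by positivity) (by positivity) hmge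
        have h4 : ∀ a : ℝ, ((t / l) ^ 2) ^ a = ((t / l) ^ a) ^ 2 := fun a => by
          rw [← Real.rpow_natCast_mul (by positivity), ← Real.rpow_mul_natCast (by positivity),
            mul_comm]
        rw [h4, h4] at h3
        simp only [h1, h2, mul_pow]
        rw [inv_mul_cancel_left₀ (by positivity)]
        gcongr
    _ = L ^ 2 * (μ.real univ + (K ^ 2)⁻¹ * ∫ t, ((t ^ p) ^ m) ^ 2 ∂μ) := by
        rw [integral_const_mul, integral_add (integrable_const 1) (hsq.const_mul _),
          integral_const_mul, integral_const, smul_eq_mul, mul_one]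
    _ ≤ L ^ 2 * V := by
        rw [← hK] at hint
        gcongr
        rw [hV]
        gcongr
        rwa [inv_mul_le_one₀ (by positivity)]
    _ ≤ (L * V ^ n) ^ 2 := by
        rw [mul_pow]
        gcongr
        rw [← pow_mul]
        exact le_self_pow₀ hV1 (by omega)
    _ ≤ _ := by
        rw [mul_pow _ V, mul_right_comm]
        gcongr

section FracPow

variable {H : Type*} [NormedAddCommGroup H] [InnerProductSpace ℝ H] [CompleteSpace H]
  {A : H →ₗ.[ℝ] H}

theorem IsPositiveSelfAdjoint.isFracPow_fracPow (hA : IsPositiveSelfAdjoint A) (α : ℝ) :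
    IsFracPow A α (fracPow A α) := by
  obtain ⟨E, hE⟩ := hA.exists_spectralFamily
  have h : ∃ B, IsFracPow A α B := ⟨_, E, hE, E.isIntegral_integral _⟩
  rw [fracPow, dif_pos h]
  exact h.choose_spec

end FracPow

end GevreyVectors

end

theorem mainTheorem8 {H : Type*} [NormedAddCommGroup H] [InnerProductSpace ℝ H] [CompleteSpace H]
    (A : H →ₗ.[ℝ] H) (hA : GevreyVectors.IsPositiveSelfAdjoint A)
    (α s : ℝ) (hα : 0 < α) (hs : 0 < s) :
    GevreyVectors.gevrey A s = GevreyVectors.gevrey (GevreyVectors.fracPow A α) (α * s) := by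
  obtain ⟨E, hE, hB⟩ := hA.isFracPow_fracPow α
  have hm : ∀ p : ℝ, Measurable fun t : ℝ => t ^ p := fun p => measurable_id.pow_const p
  have hE' : E.IsIntegral (fun t => t ^ (1 : ℝ)) A := by simpa only [Real.rpow_one] using hE
  ext u
  rw [← one_mul s, hE'.mem_gevrey_iff (hm 1), one_mul, hB.mem_gevrey_iff (hm α)]
  have hae := hE.ae_nonneg hA.nonneg u
  constructor
  · intro h
    exact GevreyVectors.gevrey_moments hae one_pos hα hs (by simpa only [one_mul] using h)
  · intro h
    simpa only [one_mul] using GevreyVectors.gevrey_moments hae hα one_pos hs h
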